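/- Let $n,l,k\ge 0$ be integers, $x\in(\mathbb C,0)$, $t\in(\mathbb C^n,0)$, $\epsilon\in(\mathbb C^l,0)$. Let $$P(x,t,\epsilon)=x^{k+1}+P_k(t,\epsilon)x^k+\dots+P_0(t,\epsilon)$$ have analytic coefficient germs with $P_j(0,0)=0$ for all $j$, and let $A(x,t,\epsilon)$ be a germ of analytic $\mathfrak{sl}_2(\mathbb C)$-valued function with $A(0,0,0)\neq 0$. Let $$\nabla_\epsilon(x,t)=\mathrm d-\Omega,\qquad \Omega=A(x,t,\epsilon)\frac{\mathrm dx}{P(x,t,\epsilon)}+\sum_{i=1}^n\Omega_i,$$ be a germ of a parametric family of flat meromorphic connections, where $\mathrm d=\mathrm d_{x,t}$ is the exterior derivative in the fibers $\{\epsilon=\mathrm{const}\}$, the $\Omega_i$ are germs of meromorphic $\mathfrak{sl}_2(\mathbb C)$-valued $\mathrm dt_i$-forms in $(x,t,\epsilon)$, and flatness means $\mathrm d\Omega=\Omega\wedge\Omega$. Assume: (1) (transversality) the polar divisors of $\Omega$ and of $\mathrm d\Omega$ are bounded by the divisor of $P$ (i.e. $P\,\Omega$ and $P\,\mathrm d\Omega$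 are analytic) and, within each fiber $\{\epsilon=\mathrm{const}\}$, are transverse to the lines $\{(t,\epsilon)=\mathrm{const}\}$; (2) (non-crossing) the restriction of $\{P=0\}$ to each fiber $\{\epsilon=\mathrm{const}\}$ has no crossings: near each of its points it is the graph $x=b(t)$ of a single analytic function. Then there exist germs at the origin of an analytic function $\phi(x,t,\epsilon)$ with $\phi(0,0,0)=0$, $\partial_x\phi(0,0,0)\ne0$, and of an analytic matrix function $T(x,t,\epsilon)$ with $\det T(0,0,0)\neq0$, such that the gauge–coordinate transformation $$(x,y,t,\epsilon)\mapsto\big(\tilde x,\tilde y,t,\epsilon\big)=\big(\phi(x,t,\epsilon),\,T(x,t,\epsilon)y,\,t,\,\epsilon\big)$$ brings $\nabla_\epsilon$ to a constant deformation (independent of $t$ and with no $\mathrm dt_i$-terms) $$\tilde\nabla_\epsilon(\tilde x,t)=\mathrm d-\begin{pmatrix}0&1\\ \tilde Q(\tilde x,\epsilon)&0\end{pmatrix}\frac{\mathrm d\tilde x}{\tilde P(\tilde x,\epsilon)},$$ where $\tilde Q$ is an analytic germ and $\tilde P(\tilde x,\epsilon)=\tilde x^{k+1}+\tilde P_k(\epsilon)\tilde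 x^k+\dots+\tilde P_0(\epsilon)$ has analytic coefficient germs with $\tilde P_j(0)=0$. Explicitly, where $P\neq0$, with $\Phi(x,t,\epsilon)=(\phi(x,t,\epsilon),t,\epsilon)$ and $\tilde\Omega$ the form of $\tilde\nabla_\epsilon$: $\tilde P\circ\Phi\neq 0$ and $\mathrm dT+T\,\Omega=(\Phi^*\tilde\Omega)\,T$. -/

import Mathlib

open Filter Topology

namespace ConfluentIso

/-- Complex `2 × 2` matrices. -/
abbrev Mat2 : Type := Matrix (Fin 2) (Fin 2) ℂ

/-- The space of triples `(x, t, ε)` with `x ∈ ℂ`, `t ∈ ℂⁿ`, `ε ∈ ℂˡ`. -/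
abbrev Total (n l : ℕ) : Type := ℂ × (Fin n → ℂ) × (Fin l → ℂ)

/-- The coordinate vector along `x` (index `none`) or along `t_i` (index `some i`): the directions
tangent to the fibres `{ε = const}`. -/
def dir {n l : ℕ} : Option (Fin n) → Total n l
  | none => (1, 0, 0)
  | some i => (0, Pi.single i 1, 0)

/-- The partial derivative `∂_a f` along `x` (`a = none`) or `t_i` (`a = some i`). -/
noncomputable def pderiv {n l : ℕ} (a : Option (Fin n)) (f : Total n l → ℂ) (z : Total n l) : ℂ :=
  fderiv ℂ f z (dir a)

/-- The entrywise partial derivative of a matrix function. -/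
noncomputable def mderiv {n l : ℕ} (a : Option (Fin n)) (F : Total n l → Mat2)
    (z : Total n l) : Mat2 :=
  Matrix.of fun i j => pderiv a (fun w => F w i j) z

/-- `F` is (the germ at the origin of) an analytic matrix function. -/
def MatAnalytic {n l : ℕ} (F : Total n l → Mat2) : Prop :=
  ∀ i j, AnalyticAt ℂ (fun z => F z i j) 0

/-- The monic polynomial `x^{k+1} + c_k(p) x^k + ⋯ + c_0(p)` with coefficients depending on a
parameter `p`. -/
def monicPoly {k : ℕ} {B : Type*} (c : Fin (k + 1) → B → ℂ) (x : ℂ) (p : B) : ℂ :=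
  x ^ (k + 1) + ∑ j : Fin (k + 1), c j p * x ^ (j : ℕ)

/-- A matrix valued 1-form `Ω = Ω_none dx + ∑ i, Ω_(some i) dt_i` relative to the parameter `ε`.
The coefficients are functions on the complement of the polar divisor; their values on the
divisor are irrelevant. -/
abbrev RelForm (n l : ℕ) : Type := Option (Fin n) → Total n l → Mat2

/-- The `dz_a ∧ dz_b` coefficient of `dΩ`, with `d = d_{x,t}`. -/
noncomputable def extDer {n l : ℕ} (Ω : RelForm n l) (a b : Option (Fin n)) (z : Total n l) :
    Mat2 :=
  mderiv a (Ω b) z - mderiv b (Ω a) z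

/-- The `dz_a ∧ dz_b` coefficient of `Ω ∧ Ω`. -/
def wedgeSelf {n l : ℕ} (Ω : RelForm n l) (a b : Option (Fin n)) (z : Total n l) : Mat2 :=
  Ω a z * Ω b z - Ω b z * Ω a z

/-- The polar divisor of the germ of matrix function `F` is bounded by the divisor `{P = 0}`
(with multiplicities): off it, `F = C / P` with `C` analytic. -/
def PolesBounded {n l : ℕ} (P : Total n l → ℂ) (F : Total n l → Mat2) : Prop :=
  ∃ C : Total n l → Mat2, MatAnalytic C ∧ ∀ᶠ z in 𝓝 (0 : Total n l), P z ≠ 0 →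
    F z = (P z)⁻¹ • C z

/-- `Ω` takes values in `sl_2(ℂ)`. -/
def IsTraceless {n l : ℕ} (P : Total n l → ℂ) (Ω : RelForm n l) : Prop :=
  ∀ᶠ z in 𝓝 (0 : Total n l), P z ≠ 0 → ∀ a, (Ω a z).trace = 0

/-- The connection `d - Ω` is flat: `dΩ = Ω ∧ Ω` off the divisor `{P = 0}`. -/
def IsFlat {n l : ℕ} (P : Total n l → ℂ) (Ω : RelForm n l) : Prop :=
  ∀ᶠ z in 𝓝 (0 : Total n l), P z ≠ 0 → ∀ a b, extDer Ω a b z = wedgeSelf Ω a b z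

/-- Inside each fibre `{ε = const}` the divisor `{P = 0}` is transverse to the lines
`{(t, ε) = const}`: near each of its points it is a finite union of branches `x = b_j(t)`. -/
def TransverseToFibration {n l : ℕ} (P : Total n l → ℂ) : Prop :=
  ∀ᶠ z₀ in 𝓝 (0 : Total n l), P z₀ = 0 →
    ∃ (m : ℕ) (b : Fin m → (Fin n → ℂ) → ℂ), (∀ j, AnalyticAt ℂ (b j) z₀.2.1) ∧
      ∀ᶠ w : ℂ × (Fin n → ℂ) in 𝓝 (z₀.1, z₀.2.1),
        (P (w.1, w.2, z₀.2.2) = 0 ↔ ∃ j, w.1 = b j w.2)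

/-- Inside each fibre `{ε = const}` the divisor `{P = 0}` has no crossings: near each of its
points it consists of a single branch `x = b(t)`. -/
def NonCrossing {n l : ℕ} (P : Total n l → ℂ) : Prop :=
  ∀ᶠ z₀ in 𝓝 (0 : Total n l), P z₀ = 0 →
    ∃ b : (Fin n → ℂ) → ℂ, AnalyticAt ℂ b z₀.2.1 ∧
      ∀ᶠ w : ℂ × (Fin n → ℂ) in 𝓝 (z₀.1, z₀.2.1),
        (P (w.1, w.2, z₀.2.2) = 0 ↔ w.1 = b w.2)

/-- The transversality condition: the polar divisors of `Ω` and of `dΩ` are bounded by `{P = 0}`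
and are transverse to the fibration `{(t, ε) = const}`. When the `dx`-part of `Ω` is `A dx / P`
with `A(0) ≠ 0`, its polar divisor is exactly `{P = 0}`; so is then that of `Ω`, and that of `dΩ`
is a part of it. -/
structure Transversality {n l : ℕ} (P : Total n l → ℂ) (Ω : RelForm n l) : Prop where
  poles : ∀ a, PolesBounded P (Ω a)
  poles_d : ∀ a b, PolesBounded P (extDer Ω a b)
  transverse : TransverseToFibration P

/-- The map `(x, t, ε) ↦ (φ(x, t, ε), t, ε)`. -/
def baseMap {n l : ℕ} (φ : Total n l → ℂ) (z : Total n l) : Total n l := (φ z, z.2)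

/-- The coefficients of the pullback of `Ω'` by `(x, t, ε) ↦ (φ(x, t, ε), t, ε)`, relative to
`ε`. -/
noncomputable def pullback {n l : ℕ} (φ : Total n l → ℂ) (Ω' : RelForm n l) : RelForm n l
  | none => fun z => pderiv none φ z • Ω' none (baseMap φ z)
  | some i => fun z => pderiv (some i) φ z • Ω' none (baseMap φ z) + Ω' (some i) (baseMap φ z)

/-- The germ of analytic gauge-coordinate transformation
`(x, y, t, ε) ↦ (φ(x, t, ε), T(x, t, ε) y, t, ε)` brings `d - Ω`, with poles in `{P = 0}`, to
`d - Ω'`, with poles in `{P' = 0}`: if `dy = Ω y` then `y' = T y` satisfies `dy' = (Φ^* Ω') y'`,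
where `Φ(x, t, ε) = (φ(x, t, ε), t, ε)`; that is `dT + T Ω = (Φ^* Ω') T`. -/
structure GaugeCoordinateTransforms {n l : ℕ} (φ : Total n l → ℂ) (T : Total n l → Mat2)
    (P : Total n l → ℂ) (Ω : RelForm n l) (P' : Total n l → ℂ) (Ω' : RelForm n l) : Prop where
  analytic_coord : AnalyticAt ℂ φ 0
  coord_zero : φ 0 = 0
  coord_deriv : pderiv none φ 0 ≠ 0
  analytic_gauge : MatAnalytic T
  gauge_det : (T 0).det ≠ 0
  transforms : ∀ᶠ z in 𝓝 (0 : Total n l), P z ≠ 0 → P' (baseMap φ z) ≠ 0 ∧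
    ∀ a, mderiv a T z + T z * Ω a z = pullback φ Ω' a z * T z

/-- The form `[[0, 1], [Q(x, ε), 0]] dx / P(x, ε)`, with no `dt_i`-terms and independent
of `t`. -/
noncomputable def constantCompanion {n l : ℕ} (P Q : ℂ → (Fin l → ℂ) → ℂ) : RelForm n l
  | none => fun z => (P z.1 z.2.2)⁻¹ • !![0, 1; Q z.1 z.2.2, 0]
  | some _ => fun _ => 0

end ConfluentIso

/-!
The theorem is proved by following the connection along the rays `s ↦ (x, s t, ε)`.

Write `Ω = (A dx + ∑ B_i dt_i) / P`. Flatness together with the bound on the poles of `dΩ` gives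
`[A, B_i] ≡ 0` modulo `P`. Since `A(0) ≠ 0`, in `sl₂` this forces `B_i ≡ -f_i A` modulo `P` for an
analytic scalar `f_i` (`double_commutator`), so that `Ω` takes analytic values `D_i` on the fields
`V_i = ∂_i + f_i ∂_x`. The `dx ∧ dt_i`-part of `dΩ` having a pole of order `P` only, `V_i` is tangent
to the divisor: `V_i P = P h_i` (`exists_tangent_field`).

The `V_i` commute only modulo `P`, but this does not matter: the single field `∑ t_i V_i` suffices.
Its flow along rays, and the gauge `S' = -S ∑ t_i D_i` which removes the analytic value of `Ω` on it,
are analytic in all variables (`exists_analyticAt_ray_solution`); this dependence on parameters comes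
from the analytic implicit function theorem in the Banach space of continuous paths. After this
transformation the connection form vanishes on the radial field, and flatness turns into a linear
differential equation along rays for its difference with its restriction to `t = 0`. This difference
vanishes at `t = 0`, hence everywhere (`gauge_defect_propagates`, `exists_radial_gauge`). The flow
multiplies `P` by a unit (`transported_eq`), so the polar divisor is rectified as well.

What remains is a system `A(x, 0, ε) dx / P(x, 0, ε)` without `t`, which a cyclic vector puts in
companion form without changing `x` or the denominator (`exists_companion_gauge`).
-/

namespace ConfluentIso

/-! ### Analytic superposition operators -/

section Superposition

variable {K V Y : Type*} [TopologicalSpace K] [CompactSpace K]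
  [NormedAddCommGroup V] [NormedSpace ℂ V] [NormedAddCommGroup Y] [NormedSpace ℂ Y]

omit [CompactSpace K] [NormedSpace ℂ V] in
theorem eval_update {ι : Type*} [DecidableEq ι] (u : ι → C(K, V)) (i : ι) (a : C(K, V)) (s : K) :
    (fun j => Function.update u i a j s) = Function.update (fun j => u j s) i (a s) := by
  funext j
  by_cases hj : j = i
  · subst hj; simp
  · simp [hj]

variable (K) in
/-- Pointwise application of a continuous multilinear map to continuous maps on a compact
space. -/
noncomputable def pointwiseMultilinear {n : ℕ}
    (m : V [×n]→L[ℂ] Y) : C(K, V) [×n]→L[ℂ] C(K, Y) :=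
  MultilinearMap.mkContinuous
    { toFun := fun u => ⟨fun s => m fun i => u i s, by fun_prop⟩
      map_update_add' := by
        intro _ u i a b
        ext s
        simp only [ContinuousMap.coe_mk, ContinuousMap.add_apply, eval_update,
          ContinuousMultilinearMap.map_update_add]
      map_update_smul' := by
        intro _ u i a b
        ext s
        simp only [ContinuousMap.coe_mk, ContinuousMap.smul_apply, eval_update,
          ContinuousMultilinearMap.map_update_smul] }
    ‖m‖ (by
      intro u
      refine (ContinuousMap.norm_le _ (by positivity)).2 fun s => ?_
      refine (m.le_opNorm _).trans ?_
      gcongr with i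
      exact (u i).norm_coe_le_norm s)

theorem pointwiseMultilinear_apply {n : ℕ} (m : V [×n]→L[ℂ] Y) (u : Fin n → C(K, V)) (s : K) :
    pointwiseMultilinear K m u s = m fun i => u i s := rfl

theorem norm_pointwiseMultilinear_le {n : ℕ} (m : V [×n]→L[ℂ] Y) :
    ‖pointwiseMultilinear K m‖ ≤ ‖m‖ :=
  MultilinearMap.mkContinuous_norm_le _ (norm_nonneg _) _

variable (K) in
/-- The superposition operator `u ↦ f ∘ u` of an analytic germ `f` is analytic on small continuous
maps: its power series is that of `f`, applied pointwise. -/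
theorem exists_analyticAt_superposition [CompleteSpace Y] {f : V → Y} (hf : AnalyticAt ℂ f 0) :
    ∃ N : C(K, V) → C(K, Y), AnalyticAt ℂ N 0 ∧ ∀ᶠ u in 𝓝 0, ∀ s, N u s = f (u s) := by
  obtain ⟨p, r, hp⟩ := hf
  let q : FormalMultilinearSeries ℂ C(K, V) C(K, Y) := fun n => pointwiseMultilinear K (p n)
  have hq : r ≤ q.radius := by
    refine hp.r_le.trans ?_
    refine ENNReal.le_of_forall_nnreal_lt fun ρ hρ => ?_
    obtain ⟨C, -, hC⟩ := p.norm_mul_pow_le_of_lt_radius hρ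
    refine q.le_radius_of_bound C fun n => le_trans ?_ (hC n)
    gcongr
    exact norm_pointwiseMultilinear_le (p n)
  have hq0 : 0 < q.radius := hp.r_pos.trans_le hq
  have hN := q.hasFPowerSeriesOnBall hq0
  refine ⟨q.sum, hN.analyticAt, ?_⟩
  filter_upwards [Metric.eball_mem_nhds (0 : C(K, V)) hp.r_pos] with u hu s
  have h1 := hN.hasSum (y := u) (Metric.eball_subset_eball hq hu)
  have h2 : HasSum (fun n => p n fun _ => u s) (q.sum u s) := by
    have := h1.mapL (ContinuousMap.evalCLM ℂ s : C(K, Y) →L[ℂ] Y)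
    simpa [q, pointwiseMultilinear_apply] using this
  have h3 : HasSum (fun n => p n fun _ => u s) (f (u s)) := by
    have hs : u s ∈ Metric.eball (0 : V) r := by
      have hle : ‖u s‖ ≤ ‖u‖ := u.norm_coe_le_norm s
      rw [mem_eball_zero_iff] at hu ⊢
      exact lt_of_le_of_lt (ENNReal.coe_le_coe.2 hle) hu
    simpa using hp.hasSum hs
  exact h2.unique h3

end Superposition

/-! ### Differential equations along rays -/

section RayEquation

variable {W T H : Type*} [NormedAddCommGroup W] [NormedSpace ℂ W]
  [NormedAddCommGroup T] [NormedSpace ℂ T] [NormedAddCommGroup H] [NormedSpace ℂ H]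

variable (W) in
/-- The primitive `u ↦ (s ↦ ∫₀ˢ u)` on continuous maps on the unit interval. -/
noncomputable def primitiveCLM : C(unitInterval, W) →L[ℂ] C(unitInterval, W) :=
  LinearMap.mkContinuous
    { toFun := fun u => ⟨fun s => ∫ r in (0 : ℝ)..s, Set.IccExtend zero_le_one u r, by
        have : Continuous fun s : ℝ => ∫ r in (0 : ℝ)..s, Set.IccExtend zero_le_one u r :=
          intervalIntegral.continuous_primitive
            (fun a b => (u.continuous.Icc_extend').intervalIntegrable a b) 0
        exact this.comp continuous_subtype_val⟩
      map_add' := by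
        intro u v
        ext s
        simp only [ContinuousMap.coe_mk, ContinuousMap.add_apply]
        rw [← intervalIntegral.integral_add
          ((u.continuous.Icc_extend').intervalIntegrable _ _)
          ((v.continuous.Icc_extend').intervalIntegrable _ _)]
        rfl
      map_smul' := by
        intro c u
        ext s
        simp only [ContinuousMap.coe_mk, ContinuousMap.smul_apply, RingHom.id_apply]
        rw [← intervalIntegral.integral_smul]
        rfl }
    1 (by
      intro u
      rw [one_mul]
      refine (ContinuousMap.norm_le _ (norm_nonneg _)).2 fun s => ?_
      have := intervalIntegral.norm_integral_le_of_norm_le_const (a := 0) (b := (s : ℝ))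
        (f := Set.IccExtend zero_le_one u) (C := ‖u‖)
        (fun r _ => u.norm_coe_le_norm (Set.projIcc 0 1 zero_le_one r))
      refine this.trans ?_
      have hs : |(s : ℝ) - 0| ≤ 1 := by
        rw [sub_zero, abs_of_nonneg s.2.1]; exact s.2.2
      nlinarith [norm_nonneg u])

theorem primitiveCLM_apply (u : C(unitInterval, W)) (s : unitInterval) :
    primitiveCLM W u s = ∫ r in (0 : ℝ)..s, Set.IccExtend zero_le_one u r := rfl

variable (W T H) in
/-- The map sending `((τ, η), u)` to the path `r ↦ (u r, r τ, η)`. -/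
noncomputable def rayPathCLM :
    (T × H) × C(unitInterval, W) →L[ℂ] C(unitInterval, W × T × H) :=
  LinearMap.mkContinuous
    { toFun := fun v => ⟨fun r => (v.2 r, ((r : ℝ) : ℂ) • v.1.1, v.1.2), by fun_prop⟩
      map_add' := by intro u v; ext s <;> simp
      map_smul' := by intro c v; ext s <;> simp [smul_comm c] }
    1 (by
      intro v
      rw [one_mul]
      refine (ContinuousMap.norm_le _ (norm_nonneg _)).2 fun s => ?_
      have h1 : ‖v.2 s‖ ≤ ‖v‖ := (v.2.norm_coe_le_norm s).trans (norm_snd_le v)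
      have h2 : ‖v.1.1‖ ≤ ‖v‖ := (norm_fst_le v.1).trans (norm_fst_le v)
      have h3 : ‖v.1.2‖ ≤ ‖v‖ := (norm_snd_le v.1).trans (norm_fst_le v)
      have h4 : ‖((s : ℝ) : ℂ) • v.1.1‖ ≤ ‖v.1.1‖ := by
        rw [norm_smul, Complex.norm_real, Real.norm_of_nonneg s.2.1]
        exact mul_le_of_le_one_left (norm_nonneg _) s.2.2
      exact max_le h1 (max_le (h4.trans h2) h3))

theorem rayPathCLM_apply (v : (T × H) × C(unitInterval, W)) (r : unitInterval) :
    rayPathCLM W T H v r = (v.2 r, ((r : ℝ) : ℂ) • v.1.1, v.1.2) := rfl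

variable (T W) in
/-- Pointwise application of a path of linear maps to a vector. -/
noncomputable def pathApplyCLM :
    C(unitInterval, T →L[ℂ] W) →L[ℂ] T →L[ℂ] C(unitInterval, W) :=
  LinearMap.mkContinuous₂
    (LinearMap.mk₂ ℂ (fun (w : C(unitInterval, T →L[ℂ] W)) (τ : T) =>
      (⟨fun r => w r τ, by fun_prop⟩ : C(unitInterval, W)))
      (by intros; ext; simp) (by intros; ext; simp) (by intros; ext; simp) (by intros; ext; simp))
    1 (by
      intro w τ
      rw [one_mul]
      refine (ContinuousMap.norm_le _ (by positivity)).2 fun s => ?_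
      exact ((w s).le_opNorm τ).trans (by gcongr; exact w.norm_coe_le_norm s))

theorem pathApplyCLM_apply (w : C(unitInterval, T →L[ℂ] W)) (τ : T) (r : unitInterval) :
    pathApplyCLM W T w τ r = w r τ := rfl

omit [NormedAddCommGroup H] [NormedSpace ℂ H] in
/-- The integral equation of a ray is invariant under rescaling: if `u` is a path for the parameter
`p = (τ, η)`, then `v r = u (s r)` has the integrals belonging to the parameter `(s τ, η)`. -/
theorem pathApplyCLM_rayPath_scale [CompleteSpace W]
    (F : W × T × H → T →L[ℂ] W) (w : C(unitInterval, T →L[ℂ] W)) (p : T × H)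
    (u : C(unitInterval, W)) (hw : ∀ r, w r = F (u r, ((r : ℝ) : ℂ) • p.1, p.2))
    (s : unitInterval) (v : C(unitInterval, W)) (hv : ∀ r, v r = u (s * r))
    (w' : C(unitInterval, T →L[ℂ] W))
    (hw' : ∀ r, w' r = F (v r, ((r : ℝ) : ℂ) • (((s : ℝ) : ℂ) • p.1), p.2)) (r : unitInterval) :
    primitiveCLM W (pathApplyCLM W T w' (((s : ℝ) : ℂ) • p.1)) r
      = primitiveCLM W (pathApplyCLM W T w p.1) (s * r) := by
  rw [primitiveCLM_apply, primitiveCLM_apply]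
  have h := intervalIntegral.smul_integral_comp_mul_left (a := 0) (b := (r : ℝ))
    (Set.IccExtend zero_le_one (pathApplyCLM W T w p.1)) (s : ℝ)
  rw [mul_zero] at h
  have hsr : ((s * r : unitInterval) : ℝ) = (s : ℝ) * r := rfl
  rw [hsr, ← h, ← intervalIntegral.integral_smul]
  refine intervalIntegral.integral_congr fun ρ hρ => ?_
  rw [Set.uIcc_of_le r.2.1] at hρ
  have hρ1 : ρ ∈ unitInterval := ⟨hρ.1, hρ.2.trans r.2.2⟩
  have hsρ : (s : ℝ) * ρ ∈ unitInterval := (s * ⟨ρ, hρ1⟩ : unitInterval).2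
  simp only [Set.IccExtend_of_mem _ _ hρ1]
  rw [Set.IccExtend_of_mem _ _ hsρ, pathApplyCLM_apply, pathApplyCLM_apply, hw, hw', hv]
  have : s * (⟨ρ, hρ1⟩ : unitInterval) = ⟨(s : ℝ) * ρ, hsρ⟩ := rfl
  rw [this, map_smul]
  simp only [smul_smul, Complex.ofReal_mul, mul_comm]
  exact Complex.coe_smul _ _

/-- The ray equation in integral form. The path `r ↦ U (r τ, η)` is found by the analytic implicit
function theorem in the space of continuous paths; that it is given by one function `U` of
`(r τ, η)` is the uniqueness part of that theorem. -/
theorem exists_analyticAt_ray_integral [CompleteSpace W] [CompleteSpace T] [CompleteSpace H]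
    (F : W × T × H → T →L[ℂ] W) (hF : AnalyticAt ℂ F 0) :
    ∃ U : T × H → W, AnalyticAt ℂ U 0 ∧ U 0 = 0 ∧ ∀ᶠ p : T × H in 𝓝 0,
      ∃ w : C(unitInterval, T →L[ℂ] W),
        (∀ r : unitInterval, w r = F (U (((r : ℝ) : ℂ) • p.1, p.2), ((r : ℝ) : ℂ) • p.1, p.2)) ∧
        ∀ s : unitInterval, U (((s : ℝ) : ℂ) • p.1, p.2)
          = primitiveCLM W (pathApplyCLM W T w p.1) s := by
  obtain ⟨N, hN, hNF⟩ := exists_analyticAt_superposition unitInterval hF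
  let f : (T × H) × C(unitInterval, W) → C(unitInterval, W) := fun v =>
    v.2 - primitiveCLM W (pathApplyCLM W T (N (rayPathCLM W T H v)) v.1.1)
  have hNL : AnalyticAt ℂ (fun v => N (rayPathCLM W T H v)) 0 := by
    have : AnalyticAt ℂ N (rayPathCLM W T H 0) := by rwa [map_zero]
    exact this.comp (f := rayPathCLM W T H) (ContinuousLinearMap.analyticAt _ _)
  have hf : AnalyticAt ℂ f 0 := by
    refine analyticAt_snd.sub ?_
    refine ((primitiveCLM W).analyticAt _).comp ?_
    exact ((pathApplyCLM W T).analyticAt_bilinear _).comp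
      (hNL.prod (analyticAt_fst.comp analyticAt_fst))
  have hf0 : f 0 = 0 := by simp [f]
  have hcd : ContDiffAt ℂ ⊤ f 0 := hf.contDiffAt
  have hfu : fderiv ℂ f 0 ∘L .inr ℂ (T × H) C(unitInterval, W) = .id ℂ _ := by
    have h1 : HasFDerivAt (fun u => f (0, u))
        (fderiv ℂ f 0 ∘L .inr ℂ (T × H) C(unitInterval, W)) 0 := by
      have h2 := hf.differentiableAt.hasFDerivAt
      exact HasFDerivAt.comp (0 : C(unitInterval, W)) (f := fun u => ((0 : T × H), u)) h2
        (hasFDerivAt_prodMk_right _ _)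
    have h3 : (fun u => f (0, u)) = id := by
      funext u; simp [f]
    rw [h3] at h1
    exact h1.unique (hasFDerivAt_id _)
  have hinv : (fderiv ℂ f 0 ∘L .inr ℂ (T × H) C(unitInterval, W)).IsInvertible := by
    rw [hfu]; exact ⟨.refl ℂ _, rfl⟩
  have htop : (⊤ : WithTop ℕ∞) ≠ 0 := by simp
  set ψ := hcd.implicitFunction htop hinv with hψ_def
  have hψ : AnalyticAt ℂ ψ 0 := by
    have := hcd.contDiffAt_implicitFunction htop hinv
    exact this.analyticAt
  have hψ0 : ψ 0 = 0 := hcd.implicitFunction_apply_self htop hinv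
  have hψf : ∀ᶠ p in 𝓝 (0 : T × H), f (p, ψ p) = 0 := by
    have := hcd.eventually_apply_implicitFunction htop hinv
    rwa [hf0] at this
  have hiff : ∀ᶠ v in 𝓝 (0 : (T × H) × C(unitInterval, W)), f v = 0 ↔ ψ v.1 = v.2 := by
    have := hcd.eventually_apply_eq_iff_implicitFunction htop hinv
    rwa [hf0] at this
  have hNF' : ∀ᶠ v in 𝓝 (0 : (T × H) × C(unitInterval, W)),
      ∀ s, N (rayPathCLM W T H v) s = F (rayPathCLM W T H v s) := by
    have : Tendsto (rayPathCLM W T H) (𝓝 0) (𝓝 0) := by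
      simpa using (rayPathCLM W T H).continuous.tendsto 0
    exact this.eventually hNF
  obtain ⟨δ, hδ, hball⟩ := Metric.eventually_nhds_iff_ball.1 (hiff.and hNF')
  have hev : ContinuousMap.evalCLM ℂ (1 : unitInterval) (0 : C(unitInterval, W)) = 0 := rfl
  refine ⟨fun p => ψ p 1, ?_, by simp [hψ0], ?_⟩
  · exact ((ContinuousMap.evalCLM ℂ (1 : unitInterval) :
      C(unitInterval, W) →L[ℂ] W).analyticAt _).comp hψ
  have hψsmall : ∀ᶠ p in 𝓝 (0 : T × H), ‖ψ p‖ < δ := by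
    have : Tendsto (fun p => ‖ψ p‖) (𝓝 0) (𝓝 0) := by
      simpa [hψ0] using hψ.continuousAt.norm.tendsto
    exact this.eventually_lt_const hδ
  filter_upwards [hψf, hψsmall, Metric.ball_mem_nhds (0 : T × H) hδ] with p hp hp1 hp2
  rw [mem_ball_zero_iff] at hp2
  have hpψ : (p, ψ p) ∈ Metric.ball (0 : (T × H) × C(unitInterval, W)) δ := by
    rw [mem_ball_zero_iff]; exact max_lt hp2 hp1
  have hsol : ψ p = primitiveCLM W (pathApplyCLM W T (N (rayPathCLM W T H (p, ψ p))) p.1) :=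
    sub_eq_zero.1 hp
  -- the rescaled path `r ↦ ψ p (s r)` solves the integral equation with parameter `(s τ, η)`
  have key : ∀ s : unitInterval, ψ (((s : ℝ) : ℂ) • p.1, p.2) 1 = ψ p s := by
    intro s
    let v : C(unitInterval, W) := (ψ p).comp ⟨fun r => s * r, by fun_prop⟩
    have hv : ∀ r, v r = ψ p (s * r) := fun r => rfl
    have hmem : ((((s : ℝ) : ℂ) • p.1, p.2), v) ∈
        Metric.ball (0 : (T × H) × C(unitInterval, W)) δ := by
      rw [mem_ball_zero_iff]
      refine max_lt (lt_of_le_of_lt (max_le ?_ (norm_snd_le p)) hp2) (lt_of_le_of_lt ?_ hp1)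
      · rw [norm_smul, Complex.norm_real, Real.norm_of_nonneg s.2.1]
        exact (mul_le_of_le_one_left (norm_nonneg _) s.2.2).trans (norm_fst_le p)
      · exact (ContinuousMap.norm_le _ (norm_nonneg _)).2 fun r => (ψ p).norm_coe_le_norm _
    have h0 : f ((((s : ℝ) : ℂ) • p.1, p.2), v) = 0 := by
      refine sub_eq_zero.2 (ContinuousMap.ext fun r => ?_)
      have h1 := pathApplyCLM_rayPath_scale F (N (rayPathCLM W T H (p, ψ p))) p (ψ p)
        (fun r => (hball _ hpψ).2 r) s v hv
        (N (rayPathCLM W T H ((((s : ℝ) : ℂ) • p.1, p.2), v)))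
        (fun r => (hball _ hmem).2 r) r
      change v r = primitiveCLM W (pathApplyCLM W T _ (((s : ℝ) : ℂ) • p.1)) r
      rw [h1, ← hsol, hv]
    have h2 := ((hball _ hmem).1).1 h0
    change ψ (((s : ℝ) : ℂ) • p.1, p.2) = v at h2
    rw [h2, hv, mul_one]
  refine ⟨N (rayPathCLM W T H (p, ψ p)), fun r => ?_, fun s => ?_⟩
  · rw [(hball _ hpψ).2 r, rayPathCLM_apply]
    simp only [key]
  · rw [← hsol]
    exact key s

/-- **Analytic solutions along rays.** If `F` is analytic at `0`, there is an analytic `U` with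
`U (0, η) = 0` such that along every short ray `s ↦ (s τ, η)` the function `u s = U (s τ, η)` solves
`u' = F (u, s τ, η) τ`. -/
theorem exists_analyticAt_ray_solution [CompleteSpace W] [CompleteSpace T] [CompleteSpace H]
    (F : W × T × H → T →L[ℂ] W) (hF : AnalyticAt ℂ F 0) :
    ∃ U : T × H → W, AnalyticAt ℂ U 0 ∧ (∀ᶠ p : T × H in 𝓝 0, p.1 = 0 → U p = 0) ∧
      ∀ᶠ p : T × H in 𝓝 0, ∀ (s : ℂ) (τ : T), p.1 = s • τ →
        fderiv ℂ U p (τ, 0) = F (U p, p) τ := by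
  obtain ⟨U, hU, hU0, hray⟩ := exists_analyticAt_ray_integral F hF
  have hUF : AnalyticAt ℂ (fun p : T × H => F (U p, p)) 0 := by
    have h1 : AnalyticAt ℂ F (U 0, (0 : T × H)) := by rw [hU0]; exact hF
    exact h1.comp (f := fun p : T × H => (U p, p)) (hU.prod analyticAt_id)
  have hzero : ∀ᶠ p : T × H in 𝓝 0, p.1 = 0 → U p = 0 := by
    filter_upwards [hray] with p hp h0
    obtain ⟨w, -, hw⟩ := hp
    have := hw 0
    rw [primitiveCLM_apply] at this
    simp only [Set.Icc.coe_zero, Complex.ofReal_zero, zero_smul,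
      intervalIntegral.integral_same] at this
    rw [← this, ← h0]
  -- the radial derivative, computed at the midpoint of the ray to `(2 τ, η)`
  have hrad : ∀ᶠ p : T × H in 𝓝 0, fderiv ℂ U p (p.1, 0) = F (U p, p) p.1 := by
    have hdbl : Tendsto (fun p : T × H => ((2 : ℂ) • p.1, p.2)) (𝓝 0) (𝓝 0) := by
      have : Continuous (fun p : T × H => ((2 : ℂ) • p.1, p.2)) := by fun_prop
      simpa [Prod.mk_zero_zero] using this.tendsto 0
    filter_upwards [hdbl.eventually hray, hU.eventually_analyticAt] with p hp hUp
    obtain ⟨w, hwF, hw⟩ := hp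
    have hhalf : (1 / 2 : ℝ) ∈ unitInterval := by constructor <;> norm_num
    have hp2 : ((((1 / 2 : ℝ) : ℝ) : ℂ) • ((2 : ℂ) • p.1), p.2) = p := by
      rw [smul_smul]; norm_num
    have hline : HasDerivAt (fun s : ℝ => (((s : ℂ)) • ((2 : ℂ) • p.1), p.2))
        ((2 : ℂ) • p.1, (0 : H)) (1 / 2) := by
      refine HasDerivAt.prodMk ?_ (hasDerivAt_const _ _)
      have h := (Complex.ofRealCLM.hasDerivAt (x := (1 / 2 : ℝ))).smul_const ((2 : ℂ) • p.1)
      simpa using h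
    have hD1 : HasDerivAt (fun s : ℝ => U (((s : ℂ)) • ((2 : ℂ) • p.1), p.2))
        (fderiv ℂ U p ((2 : ℂ) • p.1, 0)) (1 / 2) := by
      have h1 : HasFDerivAt U (fderiv ℂ U p)
          ((((1 / 2 : ℝ) : ℝ) : ℂ) • ((2 : ℂ) • p.1), p.2) := by
        rw [hp2]; exact hUp.differentiableAt.hasFDerivAt
      exact (h1.restrictScalars ℝ).comp_hasDerivAt (1 / 2 : ℝ) hline
    have hD2 : HasDerivAt (fun s : ℝ => U (((s : ℂ)) • ((2 : ℂ) • p.1), p.2))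
        (F (U p, p) ((2 : ℂ) • p.1)) (1 / 2) := by
      have hc : Continuous (Set.IccExtend zero_le_one (pathApplyCLM W T w ((2 : ℂ) • p.1))) :=
        (ContinuousMap.continuous _).Icc_extend'
      have h := (hc.integral_hasStrictDerivAt 0 (1 / 2)).hasDerivAt
      rw [Set.IccExtend_of_mem _ _ hhalf, pathApplyCLM_apply, hwF] at h
      simp only [hp2] at h
      have hloc : ∀ᶠ s : ℝ in 𝓝 (1 / 2), s ∈ unitInterval :=
        Icc_mem_nhds (by norm_num) (by norm_num)
      refine h.congr_of_eventuallyEq ?_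
      filter_upwards [hloc] with s hs
      exact hw ⟨s, hs⟩
    have h := hD1.unique hD2
    have e : ((2 : ℂ) • p.1, (0 : H)) = (2 : ℂ) • (p.1, (0 : H)) := by simp
    rw [e, map_smul, map_smul] at h
    exact smul_right_injective W (two_ne_zero) h
  refine ⟨U, hU, hzero, ?_⟩
  filter_upwards [hrad.eventually_nhds, hU.eventually_analyticAt, hUF.eventually_analyticAt]
    with p hp hUp hUFp s τ hs
  rcases eq_or_ne s 0 with rfl | hs0
  · -- the centre of the ray: pass to the limit along `(a τ, η)`, `a → 0`
    rw [zero_smul] at hs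
    let g : ℂ → T × H := fun a => (a • τ, p.2)
    have hg0 : g 0 = p := Prod.ext (by simp [g, hs]) rfl
    have hg : Continuous g := by fun_prop
    have hc1 : ContinuousAt (fun a => fderiv ℂ U (g a) (τ, 0)) 0 := by
      have : ContinuousAt (fun a => fderiv ℂ U (g a)) 0 :=
        ContinuousAt.comp (g := fderiv ℂ U) (by rw [hg0]; exact hUp.fderiv.continuousAt)
          hg.continuousAt
      exact this.clm_apply continuousAt_const
    have hc2 : ContinuousAt (fun a => F (U (g a), g a) τ) 0 := by
      have : ContinuousAt (fun a => F (U (g a), g a)) 0 :=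
        ContinuousAt.comp (g := fun p => F (U p, p)) (by rw [hg0]; exact hUFp.continuousAt)
          hg.continuousAt
      exact this.clm_apply continuousAt_const
    have he : (fun a => fderiv ℂ U (g a) (τ, 0)) =ᶠ[𝓝[≠] 0] fun a => F (U (g a), g a) τ := by
      have h1 : ∀ᶠ a in 𝓝 (0 : ℂ), fderiv ℂ U (g a) ((g a).1, 0) = F (U (g a), g a) (g a).1 := by
        have : Tendsto g (𝓝 0) (𝓝 p) := by rw [← hg0]; exact hg.tendsto 0
        exact this.eventually hp
      filter_upwards [h1.filter_mono nhdsWithin_le_nhds, self_mem_nhdsWithin] with a ha ha0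
      have e : ((g a).1, (0 : H)) = a • (τ, (0 : H)) := by simp [g]
      have e' : (g a).1 = a • τ := rfl
      rw [e, e', map_smul, map_smul] at ha
      exact smul_right_injective W ha0 ha
    have := tendsto_nhds_unique ((hc1.tendsto.mono_left nhdsWithin_le_nhds).congr' he)
      (hc2.tendsto.mono_left nhdsWithin_le_nhds)
    simp only [hg0] at this
    exact this
  · have h := hp.self_of_nhds
    have e : (p.1, (0 : H)) = s • (τ, (0 : H)) := by simp [hs]
    rw [e, map_smul, hs, map_smul] at h
    exact smul_right_injective W hs0 h

end RayEquation

/-! ### Pullbacks of flat forms -/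

section PullbackForms

variable {V E M : Type*} [NormedAddCommGroup V] [NormedSpace ℂ V]
  [NormedAddCommGroup E] [NormedSpace ℂ E] [NormedRing M] [NormedAlgebra ℂ M]

/-- The pullback of a 1-form `ω` by a map `g`. -/
noncomputable def pullbackForm (g : V → E) (ω : E → E →L[ℂ] M) (q : V) : V →L[ℂ] M :=
  (ω (g q)).comp (fderiv ℂ g q)

theorem fderiv_pullbackForm [CompleteSpace E] {g : V → E} {ω : E → E →L[ℂ] M} {a : V}
    (hg : AnalyticAt ℂ g a) (hω : DifferentiableAt ℂ ω (g a)) :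
    DifferentiableAt ℂ (pullbackForm g ω) a ∧ ∀ v w,
      fderiv ℂ (pullbackForm g ω) a v w =
        fderiv ℂ ω (g a) (fderiv ℂ g a v) (fderiv ℂ g a w) +
          ω (g a) (fderiv ℂ (fderiv ℂ g) a v w) := by
  have h1 : HasFDerivAt (fun q => ω (g q)) ((fderiv ℂ ω (g a)).comp (fderiv ℂ g a)) a :=
    hω.hasFDerivAt.comp a hg.differentiableAt.hasFDerivAt
  have h2 : HasFDerivAt (fderiv ℂ g) (fderiv ℂ (fderiv ℂ g) a) a :=
    hg.fderiv.differentiableAt.hasFDerivAt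
  have h3 := h1.clm_comp h2
  refine ⟨h3.differentiableAt, fun v w => ?_⟩
  have h4 : fderiv ℂ (pullbackForm g ω) a = _ := h3.fderiv
  rw [h4]
  simp [add_comm]

/-- Exterior differentiation commutes with pullback. -/
theorem extDeriv_pullbackForm [CompleteSpace E] {g : V → E} {ω : E → E →L[ℂ] M} {a : V}
    (hg : AnalyticAt ℂ g a) (hω : DifferentiableAt ℂ ω (g a)) (v w : V) :
    fderiv ℂ (pullbackForm g ω) a v w - fderiv ℂ (pullbackForm g ω) a w v =
      fderiv ℂ ω (g a) (fderiv ℂ g a v) (fderiv ℂ g a w) -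
        fderiv ℂ ω (g a) (fderiv ℂ g a w) (fderiv ℂ g a v) := by
  obtain ⟨-, h⟩ := fderiv_pullbackForm hg hω
  have hs : IsSymmSndFDerivAt ℂ g a :=
    (hg.contDiffAt (n := ⊤)).isSymmSndFDerivAt_of_omega
  rw [h, h, hs.eq v w]
  abel

/-- Let `S` be a gauge with `∂_v S + S Θ_v = 0`, where `Θ` is flat in the plane of `v` and `w`.
Then the failure of `S` to transform `Θ_w` into the constant `C` is propagated along `v` by a linear
equation. -/
theorem gauge_defect_propagates {S : V → M} {Θ : V → V →L[ℂ] M} {a v w : V} [CompleteSpace M] (C : M)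
    (hS : AnalyticAt ℂ S a) (hΘ : DifferentiableAt ℂ Θ a)
    (hv : ∀ᶠ q in 𝓝 a, fderiv ℂ S q v = -(S q * Θ q v))
    (hflat : fderiv ℂ Θ a v w - fderiv ℂ Θ a w v = Θ a v * Θ a w - Θ a w * Θ a v) :
    DifferentiableAt ℂ (fun q => fderiv ℂ S q w + S q * Θ q w - C * S q) a ∧
    fderiv ℂ (fun q => fderiv ℂ S q w + S q * Θ q w - C * S q) a v =
      -((fderiv ℂ S a w + S a * Θ a w - C * S a) * Θ a v) := by
  have h1 : HasFDerivAt (fderiv ℂ S) (fderiv ℂ (fderiv ℂ S) a) a :=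
    hS.fderiv.differentiableAt.hasFDerivAt
  have hS1 : HasFDerivAt S (fderiv ℂ S a) a := hS.differentiableAt.hasFDerivAt
  have hΘ1 : HasFDerivAt Θ (fderiv ℂ Θ a) a := hΘ.hasFDerivAt
  have happ : ∀ u : V, HasFDerivAt (fun q => Θ q u) ((fderiv ℂ Θ a).flip u) a := fun u => by
    simpa using hΘ1.clm_apply (hasFDerivAt_const u a)
  have happ' : ∀ u : V, HasFDerivAt (fun q => fderiv ℂ S q u)
      ((fderiv ℂ (fderiv ℂ S) a).flip u) a := fun u => by
    simpa using h1.clm_apply (hasFDerivAt_const u a)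
  have hZ := ((happ' w).add (hS1.mul' (happ w))).sub (hS1.const_mul C)
  have hvd : HasFDerivAt (fun q => -(S q * Θ q v)) ((fderiv ℂ (fderiv ℂ S) a).flip v) a :=
    (happ' v).congr_of_eventuallyEq (hv.mono fun q hq => hq.symm)
  have h2 := hvd.unique (hS1.mul' (happ v)).neg
  have h3 := DFunLike.congr_fun h2 w
  have hs : IsSymmSndFDerivAt ℂ S a :=
    (hS.contDiffAt (n := ⊤)).isSymmSndFDerivAt_of_omega
  refine ⟨hZ.differentiableAt, ?_⟩
  have h4 : fderiv ℂ (fun q => fderiv ℂ S q w + S q * Θ q w - C * S q) a = _ := hZ.fderiv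
  rw [h4]
  simp only [ContinuousLinearMap.flip_apply, neg_apply,
    add_apply, sub_apply, smul_apply,
    smul_eq_mul, MulOpposite.smul_eq_mul_unop, MulOpposite.unop_op] at h3 ⊢
  have h5 := hv.self_of_nhds
  rw [hs.eq v w, h3, h5, sub_eq_iff_eq_add.1 hflat]
  noncomm_ring

end PullbackForms

/-- A solution of `Z' = -Z d` on the unit interval that vanishes at `0` is zero. -/
theorem linear_ode_eq_zero {M : Type*} [NormedRing M] [NormedAlgebra ℂ M]
    {Z d : ℂ → M} (hd : ∀ s : ℝ, s ∈ Set.Icc (0 : ℝ) 1 → ContinuousAt d s)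
    (hZ : ∀ s : ℝ, s ∈ Set.Icc (0 : ℝ) 1 → HasDerivAt Z (-(Z s * d s)) s) (h0 : Z 0 = 0) :
    Z 1 = 0 := by
  have hdc : ContinuousOn (fun s : ℝ => d s) (Set.Icc 0 1) := fun s hs =>
    (ContinuousAt.comp (f := fun s : ℝ => (s : ℂ)) (hd s hs)
      Complex.continuous_ofReal.continuousAt).continuousWithinAt
  obtain ⟨K, hK⟩ := isCompact_Icc.exists_bound_of_continuousOn hdc
  have hK0 : 0 ≤ K := (norm_nonneg _).trans (hK 0 ⟨le_rfl, zero_le_one⟩)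
  have hZr : ∀ s : ℝ, s ∈ Set.Icc (0 : ℝ) 1 →
      HasDerivAt (fun s : ℝ => Z s) (-(Z s * d s)) s := fun s hs => 
    ((hZ s hs).scomp s (Complex.ofRealCLM.hasDerivAt (x := s))).congr_deriv (by simp)
  have := norm_le_gronwallBound_of_norm_deriv_right_le (f := fun s : ℝ => Z s)
    (f' := fun s : ℝ => -(Z s * d s)) (δ := 0) (K := K) (ε := 0) (a := 0) (b := 1)
    (fun s hs => (hZr s hs).continuousAt.continuousWithinAt)
    (fun s hs => (hZr s ⟨hs.1, hs.2.le⟩).hasDerivWithinAt) (by simp [h0])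
    (fun s hs => by
      rw [norm_neg, add_zero, mul_comm K]
      exact (norm_mul_le _ _).trans (by gcongr; exact hK s ⟨hs.1, hs.2.le⟩))
    1 ⟨zero_le_one, le_rfl⟩
  simpa [gronwallBound_ε0_δ0] using this

/-! ### Analyticity of components and compositions -/

section AnalyticLemmas

variable {V Y Z W : Type*} [NormedAddCommGroup V] [NormedSpace ℂ V]
  [NormedAddCommGroup Y] [NormedSpace ℂ Y] [NormedAddCommGroup Z] [NormedSpace ℂ Z]
  [NormedAddCommGroup W] [NormedSpace ℂ W]

@[fun_prop]
theorem analyticAt_fst_comp {g : V → Y × Z} {a : V} (hg : AnalyticAt ℂ g a) :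
    AnalyticAt ℂ (fun q => (g q).1) a :=
  analyticAt_fst.comp hg

@[fun_prop]
theorem analyticAt_snd_comp {g : V → Y × Z} {a : V} (hg : AnalyticAt ℂ g a) :
    AnalyticAt ℂ (fun q => (g q).2) a :=
  analyticAt_snd.comp hg

theorem analyticAt_clm_comp {L : V → Y →L[ℂ] Z} {K : V → W →L[ℂ] Y} {a : V}
    (hL : AnalyticAt ℂ L a) (hK : AnalyticAt ℂ K a) :
    AnalyticAt ℂ (fun q => (L q).comp (K q)) a :=
  ((ContinuousLinearMap.compL ℂ W Y Z).analyticAt_bilinear _).comp (hL.prod hK)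

end AnalyticLemmas

/-! ### Rectification along rays -/

section Radial

variable {T H M : Type*} [NormedAddCommGroup T] [NormedSpace ℂ T]
  [NormedAddCommGroup H] [NormedSpace ℂ H] [NormedRing M] [NormedAlgebra ℂ M]

/-- The point `(x, s t, ε)` on the ray through `(x, t, ε)`. -/
def rayPoint (a : ℂ × ℂ × T × H) : ℂ × T × H := (a.2.1, a.1 • a.2.2.1, a.2.2.2)

theorem analyticAt_rayPoint (a : ℂ × ℂ × T × H) : AnalyticAt ℂ rayPoint a := by
  unfold rayPoint
  fun_prop

theorem fderiv_rayPoint (a v : ℂ × ℂ × T × H) :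
    fderiv ℂ rayPoint a v = (v.2.1, a.1 • v.2.2.1 + v.1 • a.2.2.1, v.2.2.2) := by
  have h1 : HasFDerivAt (fun a : ℂ × ℂ × T × H => a.1) (.fst ℂ _ _) a := hasFDerivAt_fst
  have h2 : HasFDerivAt (fun a : ℂ × ℂ × T × H => a.2) (.snd ℂ _ _) a := hasFDerivAt_snd
  have h := h2.fst.prodMk ((h1.smul h2.snd.fst).prodMk h2.snd.snd)
  have h' : fderiv ℂ rayPoint a = _ := h.fderiv
  rw [h']
  simp

omit [NormedSpace ℂ H] in
/-- A property of points near `0` holds along the whole rays through points near `0`. -/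
theorem eventually_along_ray {Q : ℂ × T × H → Prop} (hQ : ∀ᶠ z in 𝓝 0, Q z) :
    ∀ᶠ p in 𝓝 (0 : ℂ × T × H), ∀ s ∈ Metric.ball (0 : ℂ) 2, Q (rayPoint (s, p)) := by
  obtain ⟨δ, hδ, h⟩ := Metric.eventually_nhds_iff_ball.1 hQ
  filter_upwards [Metric.ball_mem_nhds (0 : ℂ × T × H) (half_pos hδ)] with p hp s hs
  rw [mem_ball_zero_iff] at hp hs
  apply h
  rw [mem_ball_zero_iff]
  have h1 : ‖p.1‖ ≤ ‖p‖ := norm_fst_le p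
  have h2 : ‖p.2.1‖ ≤ ‖p‖ := (norm_fst_le p.2).trans (norm_snd_le p)
  have h3 : ‖p.2.2‖ ≤ ‖p‖ := (norm_snd_le p.2).trans (norm_snd_le p)
  have h4 : ‖s • p.2.1‖ < δ := by
    rw [norm_smul]
    nlinarith [norm_nonneg s, norm_nonneg p.2.1]
  exact max_lt (h1.trans_lt (by linarith)) (max_lt h4 (h3.trans_lt (by linarith)))

/-- Simultaneous analytic solution of the flow `X' = f τ`, of the linear system `S' = -S (D τ)` and
of the scalar equation `w' = -w (h τ)` along the rays `s ↦ (x, s τ, ε)`, with `X = x`, `S = 1`,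
`w = 1` at `τ = 0`. -/
theorem exists_radial_solution [CompleteSpace T] [CompleteSpace H] [CompleteSpace M]
    {f h : ℂ × T × H → T →L[ℂ] ℂ} {D : ℂ × T × H → T →L[ℂ] M}
    (hf : AnalyticAt ℂ f 0) (hh : AnalyticAt ℂ h 0) (hD : AnalyticAt ℂ D 0) :
    ∃ (X w : ℂ × T × H → ℂ) (S : ℂ × T × H → M),
      AnalyticAt ℂ X 0 ∧ AnalyticAt ℂ w 0 ∧ AnalyticAt ℂ S 0 ∧
      (∀ᶠ p in 𝓝 (0 : ℂ × T × H), p.2.1 = 0 → X p = p.1 ∧ w p = 1 ∧ S p = 1) ∧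
      ∀ᶠ p in 𝓝 (0 : ℂ × T × H), ∀ (s : ℂ) (τ : T), p.2.1 = s • τ →
        fderiv ℂ X p (0, τ, 0) = f (X p, p.2) τ ∧
        fderiv ℂ w p (0, τ, 0) = -(w p * h (X p, p.2) τ) ∧
        fderiv ℂ S p (0, τ, 0) = -(S p * D (X p, p.2) τ) := by
  -- the unknown is `u = (X - x, w - 1, S - 1)`; the parameter of the ray equation is `(x, ε)`
  let pt : (ℂ × ℂ × M) × T × (ℂ × H) → ℂ × T × H := fun q => (q.2.2.1 + q.1.1, q.2.1, q.2.2.2)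
  have hpt : AnalyticAt ℂ pt 0 := by fun_prop
  have hpt0 : pt 0 = 0 := by simp [pt, Prod.mk_zero_zero]
  have hf' : AnalyticAt ℂ (fun q => f (pt q)) 0 := AnalyticAt.comp (g := f) (by rwa [hpt0]) hpt
  have hh' : AnalyticAt ℂ (fun q => h (pt q)) 0 := AnalyticAt.comp (g := h) (by rwa [hpt0]) hpt
  have hD' : AnalyticAt ℂ (fun q => D (pt q)) 0 := AnalyticAt.comp (g := D) (by rwa [hpt0]) hpt
  let i₁ : ℂ →L[ℂ] ℂ × ℂ × M := .inl ℂ ℂ (ℂ × M)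
  let i₂ : ℂ →L[ℂ] ℂ × ℂ × M := (ContinuousLinearMap.inr ℂ ℂ (ℂ × M)).comp (.inl ℂ ℂ M)
  let i₃ : M →L[ℂ] ℂ × ℂ × M := (ContinuousLinearMap.inr ℂ ℂ (ℂ × M)).comp (.inr ℂ ℂ M)
  let F : (ℂ × ℂ × M) × T × (ℂ × H) → T →L[ℂ] ℂ × ℂ × M := fun q =>
    i₁.comp (f (pt q)) - i₂.comp ((1 + q.1.2.1) • h (pt q))
      - i₃.comp ((ContinuousLinearMap.mul ℂ M (1 + q.1.2.2)).comp (D (pt q)))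
  have hF : AnalyticAt ℂ F 0 := by
    have hu2 : AnalyticAt ℂ (fun q : (ℂ × ℂ × M) × T × (ℂ × H) => 1 + q.1.2.1) 0 := by fun_prop
    have hu3 : AnalyticAt ℂ (fun q : (ℂ × ℂ × M) × T × (ℂ × H) => 1 + q.1.2.2) 0 := by fun_prop
    refine AnalyticAt.sub (AnalyticAt.sub (analyticAt_clm_comp analyticAt_const hf')
      (analyticAt_clm_comp analyticAt_const (hu2.smul hh'))) (analyticAt_clm_comp analyticAt_const ?_)
    exact analyticAt_clm_comp (((ContinuousLinearMap.mul ℂ M).analyticAt _).comp hu3) hD'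
  obtain ⟨U, hU, hU0, hUray⟩ := exists_analyticAt_ray_solution F hF
  let σ : ℂ × T × H →L[ℂ] T × (ℂ × H) :=
    ((ContinuousLinearMap.fst ℂ T H).comp (.snd ℂ ℂ (T × H))).prod
      ((ContinuousLinearMap.fst ℂ ℂ (T × H)).prod
        ((ContinuousLinearMap.snd ℂ T H).comp (.snd ℂ ℂ (T × H))))
  have hσ : Tendsto σ (𝓝 0) (𝓝 0) := by simpa using σ.continuous.tendsto 0
  have hUσ : AnalyticAt ℂ (fun p => U (σ p)) 0 :=
    AnalyticAt.comp (g := U) (by rwa [map_zero]) (σ.analyticAt 0)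
  refine ⟨fun p => p.1 + (U (σ p)).1, fun p => 1 + (U (σ p)).2.1, fun p => 1 + (U (σ p)).2.2,
    analyticAt_fst.add (analyticAt_fst_comp hUσ),
    analyticAt_const.add (analyticAt_fst_comp (analyticAt_snd_comp hUσ)),
    analyticAt_const.add (analyticAt_snd_comp (analyticAt_snd_comp hUσ)), ?_, ?_⟩
  · filter_upwards [hσ.eventually hU0] with p hp h0
    rw [hp h0]
    simp
  · filter_upwards [hσ.eventually hUray, hσ.eventually hU.eventually_analyticAt] with p hp hUp s τ hs
    have hd : HasFDerivAt (fun p => U (σ p)) ((fderiv ℂ U (σ p)).comp σ) p :=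
      hUp.differentiableAt.hasFDerivAt.comp p σ.hasFDerivAt
    have hray := hp s τ hs
    have h1 := ((hasFDerivAt_fst (𝕜 := ℂ) (p := p)).add hd.fst).fderiv
    have h2 := (hd.snd.fst.const_add 1).fderiv
    have h3 := (hd.snd.snd.const_add 1).fderiv
    have hστ : σ (0, τ, 0) = (τ, 0) := rfl
    have hpU : pt (U (σ p), σ p) = (p.1 + (U (σ p)).1, p.2) := rfl
    refine ⟨?_, ?_, ?_⟩
    · refine (DFunLike.congr_fun h1 _).trans ?_
      simp [hστ, hray, F, i₁, i₂, i₃, hpU]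
    · refine (DFunLike.congr_fun h2 _).trans ?_
      simp [hστ, hray, F, i₁, i₂, i₃, hpU]
    · refine (DFunLike.congr_fun h3 _).trans ?_
      simp only [ContinuousLinearMap.comp_apply, hστ, hray, F, i₁, i₂, i₃, hpU]
      simp [add_mul, add_comm]

/-- Functions that agree on the slice `t = 0` have the same derivatives along it. -/
theorem fderiv_eq_of_eq_on_slice {Y : Type*} [NormedAddCommGroup Y] [NormedSpace ℂ Y]
    {g k : ℂ × T × H → Y} {p u : ℂ × T × H} (hg : DifferentiableAt ℂ g p)
    (hk : DifferentiableAt ℂ k p) (h : ∀ᶠ q in 𝓝 p, q.2.1 = 0 → g q = k q)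
    (hp : p.2.1 = 0) (hu : u.2.1 = 0) : fderiv ℂ g p u = fderiv ℂ k p u := by
  have hl : HasDerivAt (fun a : ℂ => p + a • u) u 0 := by
    simpa using ((hasDerivAt_id (0 : ℂ)).smul_const u).const_add p
  have hp0 : p = p + (0 : ℂ) • u := by simp
  have h1 : HasDerivAt (fun a : ℂ => g (p + a • u)) (fderiv ℂ g p u) 0 :=
    HasFDerivAt.comp_hasDerivAt 0 (by rw [← hp0]; exact hg.hasFDerivAt) hl
  have h2 : HasDerivAt (fun a : ℂ => k (p + a • u)) (fderiv ℂ k p u) 0 :=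
    HasFDerivAt.comp_hasDerivAt 0 (by rw [← hp0]; exact hk.hasFDerivAt) hl
  refine h1.unique (h2.congr_of_eventuallyEq ?_)
  have ht : Tendsto (fun a : ℂ => p + a • u) (𝓝 0) (𝓝 p) := by
    have := hl.continuousAt.tendsto
    rwa [← hp0] at this
  filter_upwards [ht.eventually h] with a ha
  exact ha (by simp [hp, hu])

/-- Along the rays of the flow of `(f τ, τ, 0)`, a function `P` with `V P = P h` is transported
multiplicatively. -/
theorem transported_eq {f h : ℂ × T × H → T →L[ℂ] ℂ} {P X w : ℂ × T × H → ℂ}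
    (hP : AnalyticAt ℂ P 0) (hX : AnalyticAt ℂ X 0) (hw : AnalyticAt ℂ w 0)
    (hPh : ∀ᶠ z in 𝓝 (0 : ℂ × T × H), ∀ τ, fderiv ℂ P z (f z τ, τ, 0) = P z * h z τ)
    (hinit : ∀ᶠ p in 𝓝 (0 : ℂ × T × H), p.2.1 = 0 → X p = p.1 ∧ w p = 1)
    (hray : ∀ᶠ p in 𝓝 (0 : ℂ × T × H), ∀ (s : ℂ) (τ : T), p.2.1 = s • τ →
        fderiv ℂ X p (0, τ, 0) = f (X p, p.2) τ ∧
        fderiv ℂ w p (0, τ, 0) = -(w p * h (X p, p.2) τ)) :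
    ∀ᶠ p in 𝓝 (0 : ℂ × T × H), w p * P (X p, p.2) = P (p.1, 0, p.2.2) := by
  have hX0 : X 0 = 0 := (hinit.self_of_nhds rfl).1
  have hΨ : Tendsto (fun p : ℂ × T × H => (X p, p.2)) (𝓝 0) (𝓝 0) := by
    have : ContinuousAt (fun p : ℂ × T × H => (X p, p.2)) 0 :=
      hX.continuousAt.prodMk continuous_snd.continuousAt
    simpa [ContinuousAt, hX0, Prod.mk_zero_zero] using this
  have hgood := hX.eventually_analyticAt.and (hw.eventually_analyticAt.and (hinit.and
    (hray.and (hΨ.eventually (hP.eventually_analyticAt.and hPh)))))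
  filter_upwards [eventually_along_ray hgood] with p hp
  let k : ℂ → ℂ := fun s => w (rayPoint (s, p)) * P (X (rayPoint (s, p)), (rayPoint (s, p)).2)
  have hk : ∀ s ∈ Metric.ball (0 : ℂ) 2, HasDerivAt k 0 s := by
    intro s hs
    obtain ⟨hXa, hwa, -, hr, hPa, hPv⟩ := hp s hs
    obtain ⟨hr1, hr2⟩ := hr s p.2.1 rfl
    set q := rayPoint (s, p)
    have hl : HasDerivAt (fun s : ℂ => rayPoint (s, p)) (0, p.2.1, 0) s := by
      have h1 := (analyticAt_rayPoint (s, p)).differentiableAt.hasFDerivAt.comp_hasDerivAt s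
        ((hasDerivAt_id s).prodMk (hasDerivAt_const s p))
      exact h1.congr_deriv (by rw [fderiv_rayPoint]; simp)
    have hX1 : HasDerivAt (fun s : ℂ => X (rayPoint (s, p))) (f (X q, q.2) p.2.1) s := by
      rw [← hr1]; exact hXa.differentiableAt.hasFDerivAt.comp_hasDerivAt s hl
    have hw1 : HasDerivAt (fun s : ℂ => w (rayPoint (s, p))) (-(w q * h (X q, q.2) p.2.1)) s := by
      rw [← hr2]; exact hwa.differentiableAt.hasFDerivAt.comp_hasDerivAt s hl
    have hP1 : HasDerivAt (fun s : ℂ => P (X (rayPoint (s, p)), (rayPoint (s, p)).2))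
        (P (X q, q.2) * h (X q, q.2) p.2.1) s := by
      rw [← hPv]
      exact HasFDerivAt.comp_hasDerivAt (f := fun s => (X (rayPoint (s, p)), (rayPoint (s, p)).2)) s
        hPa.differentiableAt.hasFDerivAt (hX1.prodMk hl.snd)
    refine (hw1.mul hP1).congr_deriv ?_
    ring
  have hconst : k 1 = k 0 :=
    Metric.isOpen_ball.is_const_of_deriv_eq_zero (convex_ball _ _).isPreconnected
      (fun s hs => (hk s hs).differentiableAt.differentiableWithinAt)
      (fun s hs => (hk s hs).deriv) (by simp) (by simp)
  have h1 : rayPoint (1, p) = p := by simp [rayPoint]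
  have h0 : rayPoint (0, p) = (p.1, 0, p.2.2) := by simp [rayPoint]
  obtain ⟨-, -, hi, -⟩ := hp 0 (by simp)
  rw [h0] at hi
  obtain ⟨hi1, hi2⟩ := hi rfl
  simpa only [k, h1, h0, hi1, hi2, one_mul] using hconst

/-- **Rectification of a flat connection along rays.** Let `ω` be flat off `P = 0`, and suppose that
on the vector fields `(f τ, τ, 0)`, which are tangent to `P = 0`, it takes the analytic values
`D τ`. Then an analytic change of coordinate `X` and an analytic gauge `S` transform `ω` to its
restriction to `t = 0`. -/
theorem exists_radial_gauge [CompleteSpace T] [CompleteSpace H] [CompleteSpace M]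
    {f h : ℂ × T × H → T →L[ℂ] ℂ} {D : ℂ × T × H → T →L[ℂ] M}
    {P : ℂ × T × H → ℂ} {ω : ℂ × T × H → ℂ × T × H →L[ℂ] M}
    (hf : AnalyticAt ℂ f 0) (hh : AnalyticAt ℂ h 0) (hD : AnalyticAt ℂ D 0)
    (hP : AnalyticAt ℂ P 0)
    (hω : ∀ᶠ z in 𝓝 (0 : ℂ × T × H), P z ≠ 0 → DifferentiableAt ℂ ω z)
    (hflat : ∀ᶠ z in 𝓝 (0 : ℂ × T × H), P z ≠ 0 → ∀ v w : ℂ × T × H, v.2.2 = 0 → w.2.2 = 0 →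
      fderiv ℂ ω z v w - fderiv ℂ ω z w v = ω z v * ω z w - ω z w * ω z v)
    (hωD : ∀ᶠ z in 𝓝 (0 : ℂ × T × H), P z ≠ 0 → ∀ τ, ω z (f z τ, τ, 0) = D z τ)
    (hPh : ∀ᶠ z in 𝓝 (0 : ℂ × T × H), ∀ τ, fderiv ℂ P z (f z τ, τ, 0) = P z * h z τ) :
    ∃ (X : ℂ × T × H → ℂ) (S : ℂ × T × H → M), AnalyticAt ℂ X 0 ∧ AnalyticAt ℂ S 0 ∧
      (∀ᶠ p in 𝓝 (0 : ℂ × T × H), p.2.1 = 0 → X p = p.1 ∧ S p = 1) ∧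
      ∀ᶠ p in 𝓝 (0 : ℂ × T × H), P (X p, p.2) ≠ 0 → P (p.1, 0, p.2.2) ≠ 0 ∧
        ∀ v : ℂ × T × H, v.2.2 = 0 →
          fderiv ℂ S p v + S p * ω (X p, p.2) (fderiv ℂ X p v, v.2) =
            ω (p.1, 0, p.2.2) (v.1, 0, 0) * S p := by
  obtain ⟨X, w, S, hX, hw, hS, hinit, hray⟩ := exists_radial_solution hf hh hD
  refine ⟨X, S, hX, hS, hinit.mono fun p hp h0 => ⟨(hp h0).1, (hp h0).2.2⟩, ?_⟩
  have hX0 : X 0 = 0 := (hinit.self_of_nhds rfl).1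
  have hw0 : w 0 = 1 := (hinit.self_of_nhds rfl).2.1
  have hΨ : Tendsto (fun p : ℂ × T × H => (X p, p.2)) (𝓝 0) (𝓝 0) := by
    have : ContinuousAt (fun p : ℂ × T × H => (X p, p.2)) 0 :=
      hX.continuousAt.prodMk continuous_snd.continuousAt
    simpa [ContinuousAt, hX0, Prod.mk_zero_zero] using this
  have htrans := transported_eq hP hX hw hPh
    (hinit.mono fun p hp h0 => ⟨(hp h0).1, (hp h0).2.1⟩)
    (hray.mono fun p hp s τ hs => ⟨(hp s τ hs).1, (hp s τ hs).2.1⟩)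
  have hwne : ∀ᶠ p in 𝓝 (0 : ℂ × T × H), w p ≠ 0 :=
    hw.continuousAt.eventually_ne (by rw [hw0]; exact one_ne_zero)
  have hgood := hX.eventually_analyticAt.and (hS.eventually_analyticAt.and (hinit.and
    (hray.and (htrans.and (hΨ.eventually (hP.eventually_analyticAt.and
      (hω.and (hflat.and hωD))))))))
  filter_upwards [eventually_along_ray hgood.eventually_nhds, hwne] with p hp hwp hPp
  have h1 : rayPoint (1, p) = p := by simp [rayPoint]
  have h0 : rayPoint (0, p) = (p.1, 0, p.2.2) := by simp [rayPoint]
  have hP0 : P (p.1, 0, p.2.2) ≠ 0 := by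
    have := (hp 1 (by simp)).self_of_nhds.2.2.2.2.1
    rw [h1] at this
    rw [← this]
    exact mul_ne_zero hwp hPp
  refine ⟨hP0, fun v hv => ?_⟩
  let Ψ : ℂ × ℂ × T × H → ℂ × T × H := fun a => (X (rayPoint a), (rayPoint a).2)
  let Sr : ℂ × ℂ × T × H → M := fun a => S (rayPoint a)
  have hPs : ∀ s ∈ Metric.ball (0 : ℂ) 2, P (Ψ (s, p)) ≠ 0 := by
    intro s hs
    have : w _ * P _ = P (p.1, 0, p.2.2) := (hp s hs).self_of_nhds.2.2.2.2.1
    exact right_ne_zero_of_mul (this ▸ hP0)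
  have hSr : ∀ a, AnalyticAt ℂ S (rayPoint a) → AnalyticAt ℂ Sr a ∧
      ∀ u, fderiv ℂ Sr a u = fderiv ℂ S (rayPoint a) (fderiv ℂ rayPoint a u) := fun a ha =>
    ⟨ha.comp (analyticAt_rayPoint a), fun u => DFunLike.congr_fun
      (fderiv_comp a ha.differentiableAt (analyticAt_rayPoint a).differentiableAt) u⟩
  have hΨr : ∀ a, AnalyticAt ℂ X (rayPoint a) → AnalyticAt ℂ Ψ a ∧
      ∀ u, fderiv ℂ Ψ a u = (fderiv ℂ X (rayPoint a) (fderiv ℂ rayPoint a u),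
        (fderiv ℂ rayPoint a u).2) := fun a ha => by
    have hr := analyticAt_rayPoint a
    have hd := (ha.differentiableAt.hasFDerivAt.comp a hr.differentiableAt.hasFDerivAt).prodMk
      hr.differentiableAt.hasFDerivAt.snd
    exact ⟨(ha.comp hr).prod (analyticAt_snd_comp hr), fun u => DFunLike.congr_fun hd.fderiv u⟩
  let Θ := pullbackForm Ψ ω
  let Z : ℂ × ℂ × T × H → M := fun a =>
    fderiv ℂ Sr a (0, v) + Sr a * Θ a (0, v) - ω (p.1, 0, p.2.2) (v.1, 0, 0) * Sr a
  have hline : ∀ s : ℂ, HasDerivAt (fun s : ℂ => (s, p)) (1, 0) s := fun s =>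
    (hasDerivAt_id s).prodMk (hasDerivAt_const s p)
  have hstep : ∀ s ∈ Metric.ball (0 : ℂ) 2, DifferentiableAt ℂ Θ (s, p) ∧
      HasDerivAt (fun s => Z (s, p)) (-(Z (s, p) * Θ (s, p) (1, 0))) s := by
    intro s hs
    obtain ⟨hXa, hSa, -, -, -, -, hωa, hfl, -⟩ := (hp s hs).self_of_nhds
    obtain ⟨hΨa, hΨd⟩ := hΨr (s, p) hXa
    obtain ⟨hSra, -⟩ := hSr (s, p) hSa
    have hPsp := hPs s hs
    have hΘ := (fderiv_pullbackForm hΨa (hωa hPsp)).1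
    have hfl' := extDeriv_pullbackForm hΨa (hωa hPsp) (1, 0) (0, v)
    rw [hfl hPsp _ _ (by rw [hΨd, fderiv_rayPoint]; rfl)
      (by rw [hΨd, fderiv_rayPoint]; exact hv)] at hfl'
    have hvert : ∀ᶠ a in 𝓝 (s, p), fderiv ℂ Sr a (1, 0) = -(Sr a * Θ a (1, 0)) := by
      have hcont := (analyticAt_rayPoint (s, p)).continuousAt
      have hPa : ContinuousAt (fun a => P (Ψ a)) (s, p) :=
        ContinuousAt.comp (g := P) ((hp s hs).self_of_nhds.2.2.2.2.2.1).continuousAt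
          hΨa.continuousAt
      filter_upwards [hcont.eventually (hp s hs), hPa.eventually_ne hPsp] with a ha hPa
      obtain ⟨hXa, hSa, -, hr, -, -, -, -, hD⟩ := ha
      obtain ⟨hr1, -, hr3⟩ := hr a.1 a.2.2.1 rfl
      have e : fderiv ℂ rayPoint a (1, 0) = (0, a.2.2.1, 0) := by
        rw [fderiv_rayPoint]; simp
      have e2 : fderiv ℂ Ψ a (1, 0) = (f (Ψ a) a.2.2.1, a.2.2.1, 0) := by
        rw [(hΨr a hXa).2, e, hr1]
      rw [(hSr a hSa).2, e, hr3]
      change _ = -(_ * ω (Ψ a) (fderiv ℂ Ψ a (1, 0)))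
      rw [e2, hD hPa]
    obtain ⟨hZ1, hZ2⟩ := gauge_defect_propagates (ω (p.1, 0, p.2.2) (v.1, 0, 0)) hSra hΘ hvert hfl'
    refine ⟨hΘ, ?_⟩
    have := hZ1.hasFDerivAt.comp_hasDerivAt s (hline s)
    rw [hZ2] at this
    exact this
  have hsub : ∀ s : ℝ, s ∈ Set.Icc (0 : ℝ) 1 → (s : ℂ) ∈ Metric.ball (0 : ℂ) 2 := by
    intro s hs
    rw [mem_ball_zero_iff, Complex.norm_real, Real.norm_of_nonneg hs.1]
    linarith [hs.2]
  have hZ10 : Z (1, p) = 0 := by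
    refine linear_ode_eq_zero (Z := fun s => Z (s, p)) (d := fun s => Θ (s, p) (1, 0))
      (fun s hs => ?_) (fun s hs => (hstep s (hsub s hs)).2) ?_
    · exact (ContinuousAt.comp (g := Θ) (f := fun s : ℂ => (s, p))
        (hstep s (hsub s hs)).1.continuousAt
        (hline s).continuousAt).clm_apply continuousAt_const
    · have hp0 := hp 0 (by simp)
      obtain ⟨hXa, hSa, hi, -⟩ := hp0.self_of_nhds
      have hr2 : (rayPoint ((0 : ℂ), p)).2.1 = 0 := by simp [rayPoint]
      have e : fderiv ℂ rayPoint ((0 : ℂ), p) (0, v) = (v.1, 0, 0) := by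
        rw [fderiv_rayPoint]; simp [hv]
      have hdX : fderiv ℂ X (rayPoint ((0 : ℂ), p)) (v.1, 0, 0) = v.1 := by
        rw [fderiv_eq_of_eq_on_slice (k := Prod.fst) hXa.differentiableAt differentiableAt_fst
          (hp0.mono fun q hq h0 => (hq.2.2.1 h0).1) hr2 rfl]
        simp [fderiv_fst]
      have hdS : fderiv ℂ S (rayPoint ((0 : ℂ), p)) (v.1, 0, 0) = 0 := by
        rw [fderiv_eq_of_eq_on_slice (k := fun _ => 1) hSa.differentiableAt
          (differentiableAt_const _) (hp0.mono fun q hq h0 => (hq.2.2.1 h0).2.2) hr2 rfl]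
        simp
      obtain ⟨hi1, -, hi3⟩ := hi hr2
      have eΘ : Θ ((0 : ℂ), p) (0, v) = ω (p.1, 0, p.2.2) (v.1, 0, 0) := by
        change ω (Ψ ((0 : ℂ), p)) (fderiv ℂ Ψ ((0 : ℂ), p) (0, v)) = _
        rw [(hΨr _ hXa).2, e, hdX]
        congr 2
        exact Prod.ext hi1 (by change (rayPoint ((0 : ℂ), p)).2 = _; rw [h0])
      change fderiv ℂ Sr ((0 : ℂ), p) (0, v) + S (rayPoint ((0 : ℂ), p)) * Θ ((0 : ℂ), p) (0, v)
        - _ * S (rayPoint ((0 : ℂ), p)) = 0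
      rw [(hSr _ hSa).2, e, hdS, hi3, eΘ]
      simp
  obtain ⟨hXa, hSa, -⟩ := (hp 1 (by simp)).self_of_nhds
  have e : fderiv ℂ rayPoint ((1 : ℂ), p) (0, v) = v := by
    rw [fderiv_rayPoint]; simp
  have hZ : fderiv ℂ Sr ((1 : ℂ), p) (0, v)
      + S (rayPoint ((1 : ℂ), p)) * ω (Ψ ((1 : ℂ), p)) (fderiv ℂ Ψ ((1 : ℂ), p) (0, v))
      - ω (p.1, 0, p.2.2) (v.1, 0, 0) * S (rayPoint ((1 : ℂ), p)) = 0 := hZ10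
  have hΨ1 : Ψ ((1 : ℂ), p) = (X p, p.2) := by simp only [Ψ, h1]
  rw [(hSr _ hSa).2, (hΨr _ hXa).2, e, hΨ1, h1] at hZ
  exact sub_eq_zero.1 hZ

end Radial

section MatrixNorm

attribute [local instance] Matrix.linftyOpNormedRing Matrix.linftyOpNormedAlgebra

/-! ### Matrix-valued functions -/

section MatrixFunctions

variable {V : Type*} [NormedAddCommGroup V] [NormedSpace ℂ V]

/-- The `(i, j)` entry as a continuous linear form. -/
noncomputable def entryCLM (i j : Fin 2) : Mat2 →L[ℂ] ℂ :=
  LinearMap.toContinuousLinearMap (Matrix.entryLinearMap ℂ ℂ i j)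

theorem analyticAt_matrix_iff {F : V → Mat2} {a : V} :
    AnalyticAt ℂ F a ↔ ∀ i j, AnalyticAt ℂ (fun z => F z i j) a := by
  constructor
  · intro h i j
    exact ((entryCLM i j).analyticAt _).comp h
  · intro h
    have e : F = fun z => ∑ i, ∑ j, F z i j • Matrix.single i j (1 : ℂ) := by
      funext z
      simpa [Matrix.smul_single] using Matrix.matrix_eq_sum_single (F z)
    rw [e]
    exact Finset.analyticAt_fun_sum _ fun i _ => Finset.analyticAt_fun_sum _ fun j _ =>
      (h i j).smul analyticAt_const

theorem fderiv_matrix_apply {F : V → Mat2} {a : V} (hF : DifferentiableAt ℂ F a) (v : V)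
    (i j : Fin 2) : fderiv ℂ (fun z => F z i j) a v = fderiv ℂ F a v i j :=
  DFunLike.congr_fun ((entryCLM i j).hasFDerivAt.comp a hF.hasFDerivAt).fderiv v

theorem mderiv_eq_fderiv {n l : ℕ} (a : Option (Fin n)) {F : Total n l → Mat2} {z : Total n l}
    (hF : DifferentiableAt ℂ F z) : mderiv a F z = fderiv ℂ F z (dir a) := by
  ext i j
  exact fderiv_matrix_apply hF (dir a) i j

/-- The linear form `M ↦ tr (L M)`. -/
noncomputable def traceForm (L : Mat2) : Mat2 →L[ℂ] ℂ :=
  LinearMap.toContinuousLinearMap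
    ((Matrix.traceLinearMap (Fin 2) ℂ ℂ).comp (LinearMap.mulLeft ℂ L))

theorem traceForm_apply (L M : Mat2) : traceForm L M = (L * M).trace := rfl

/-- The double commutator in `sl₂`: the vector triple product formula. -/
theorem double_commutator {L A B : Mat2} (hL : L.trace = 0) (hA : A.trace = 0) (hB : B.trace = 0) :
    (L * A).trace • B - (L * B).trace • A =
      (1 / 2 : ℂ) • (L * (A * B - B * A) - (A * B - B * A) * L) := by
  rw [Matrix.trace_fin_two] at hL hA hB
  have hL' := eq_neg_of_add_eq_zero_right hL
  have hA' := eq_neg_of_add_eq_zero_right hA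
  have hB' := eq_neg_of_add_eq_zero_right hB
  ext i j
  fin_cases i <;> fin_cases j <;>
    simp [Matrix.trace_fin_two, Matrix.mul_apply, Fin.sum_univ_two, hL', hA', hB'] <;> ring

end MatrixFunctions

/-! ### The divisor of a monic polynomial -/

section Divisor

variable {n l k : ℕ} {c : Fin (k + 1) → ((Fin n → ℂ) × (Fin l → ℂ)) → ℂ}

theorem analyticAt_monicPoly (hc : ∀ j, AnalyticAt ℂ (c j) 0) :
    AnalyticAt ℂ (fun z : Total n l => monicPoly c z.1 z.2) 0 := by
  unfold monicPoly
  refine (analyticAt_fst.pow _).add (Finset.analyticAt_fun_sum _ fun j _ => ?_)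
  exact ((hc j).comp (f := fun z : Total n l => z.2) (x := 0) analyticAt_snd).mul
    (analyticAt_fst.pow _)

theorem not_eventually_monicPoly_eq_zero (z : Total n l) :
    ¬ ∀ᶠ w in 𝓝 z, monicPoly c w.1 w.2 = 0 := by
  intro h
  have h1 : ∀ᶠ x in 𝓝 z.1, monicPoly c x z.2 = 0 := by
    have : Tendsto (fun x : ℂ => (x, z.2)) (𝓝 z.1) (𝓝 z) :=
      (Continuous.tendsto (by fun_prop) z.1 : Tendsto (fun x : ℂ => (x, z.2)) (𝓝 z.1) (𝓝 (z.1, z.2)))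
    exact this.eventually h
  let q : Polynomial ℂ := Polynomial.X ^ (k + 1) +
    ∑ j : Fin (k + 1), Polynomial.C (c j z.2) * Polynomial.X ^ (j : ℕ)
  have hq : q.Monic := Polynomial.monic_X_pow_add (Polynomial.degree_sum_fin_lt _)
  have hroot : ∀ᶠ x in 𝓝 z.1, q.IsRoot x := by
    filter_upwards [h1] with x hx
    simpa [q, Polynomial.IsRoot, Polynomial.eval_finsetSum, monicPoly] using hx
  exact hq.ne_zero (Polynomial.eq_zero_of_infinite_isRoot q (infinite_of_mem_nhds z.1 hroot))

/-- The complement of `{P = 0}` is dense: analytic identities extend across the divisor. -/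
theorem eventually_eq_of_eq_off_divisor {Y : Type*} [NormedAddCommGroup Y] [NormedSpace ℂ Y]
    {f g : Total n l → Y} [CompleteSpace Y]
    (hf : AnalyticAt ℂ f 0) (hg : AnalyticAt ℂ g 0)
    (h : ∀ᶠ z : Total n l in 𝓝 0, monicPoly c z.1 z.2 ≠ 0 → f z = g z) :
    ∀ᶠ z in 𝓝 0, f z = g z := by
  filter_upwards [h.eventually_nhds, hf.eventually_analyticAt, hg.eventually_analyticAt]
    with z hz hfz hgz
  by_contra hne
  refine not_eventually_monicPoly_eq_zero (c := c) z ?_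
  filter_upwards [hz, (hfz.continuousAt.ne_iff_eventually_ne hgz.continuousAt).1 hne] with w hw hw'
  by_contra hP
  exact hw' (hw hP)

end Divisor

/-! ### Companion form in one variable -/

section CompanionForm

variable {H : Type*} [NormedAddCommGroup H] [NormedSpace ℂ H]

/-- A traceless system with non-vanishing upper right entry `b` is brought to companion form by the
lower triangular gauge with diagonal `α, α b`, where `α = (b / b(0))^{-1/2}`: the remaining diagonal
term of the transformed system is a multiple of `2 α' b + α b' = 0`. -/
theorem exists_companion_gauge_of_entry_ne_zero {A : ℂ × H → Mat2} {P : ℂ × H → ℂ}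
    (hA : AnalyticAt ℂ A 0) (hP : AnalyticAt ℂ P 0) (htr : ∀ᶠ z in 𝓝 0, (A z).trace = 0)
    (hA0 : A 0 0 1 ≠ 0) :
    ∃ (R : ℂ × H → Mat2) (Q : ℂ × H → ℂ), AnalyticAt ℂ R 0 ∧ AnalyticAt ℂ Q 0 ∧
      (R 0).det ≠ 0 ∧
      ∀ᶠ z in 𝓝 0, P z • fderiv ℂ R z (1, 0) + R z * A z = !![0, 1; Q z, 0] * R z := by
  have hAe := analyticAt_matrix_iff.1 hA
  let a : ℂ × H → ℂ := fun z => A z 0 0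
  let b : ℂ × H → ℂ := fun z => A z 0 1
  let c : ℂ × H → ℂ := fun z => A z 1 0
  have ha : AnalyticAt ℂ a 0 := hAe 0 0
  have hb : AnalyticAt ℂ b 0 := hAe 0 1
  have hc : AnalyticAt ℂ c 0 := hAe 1 0
  let α : ℂ × H → ℂ := fun z => Complex.exp (-(1 / 2) * Complex.log (b z / b 0))
  have hslit : ∀ᶠ z in 𝓝 (0 : ℂ × H), b z / b 0 ∈ Complex.slitPlane := by
    have : ContinuousAt (fun z => b z / b 0) 0 := hb.continuousAt.div_const _
    refine this.eventually (Complex.isOpen_slitPlane.mem_nhds ?_)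
    change b 0 / b 0 ∈ _
    rw [div_self hA0]
    exact Complex.one_mem_slitPlane
  have hα : AnalyticAt ℂ α 0 :=
    (analyticAt_const.mul ((hb.div analyticAt_const hA0).clog hslit.self_of_nhds)).cexp
  let dx : (ℂ × H → ℂ) → ℂ × H → ℂ := fun g z => fderiv ℂ g z (1, 0)
  have hdx : ∀ {g : ℂ × H → ℂ}, AnalyticAt ℂ g 0 → AnalyticAt ℂ (dx g) 0 := fun {g} hg =>
    ((ContinuousLinearMap.apply ℂ ℂ ((1 : ℂ), (0 : H))).analyticAt _).comp hg.fderiv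
  let β : ℂ × H → ℂ := fun z => P z * dx α z + α z * a z
  let γ : ℂ × H → ℂ := fun z => α z * b z
  have hβ : AnalyticAt ℂ β 0 := (hP.mul (hdx hα)).add (hα.mul ha)
  have hγ : AnalyticAt ℂ γ 0 := hα.mul hb
  have hα0 : ∀ z, α z ≠ 0 := fun z => Complex.exp_ne_zero _
  let Q : ℂ × H → ℂ := fun z => (P z * dx β z + β z * a z + γ z * c z) / α z
  have hQ : AnalyticAt ℂ Q 0 :=
    (((hP.mul (hdx hβ)).add (hβ.mul ha)).add (hγ.mul hc)).div hα (hα0 0)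
  let R : ℂ × H → Mat2 := fun z => !![α z, 0; β z, γ z]
  have hR : AnalyticAt ℂ R 0 := by
    refine analyticAt_matrix_iff.2 fun i j => ?_
    fin_cases i <;> fin_cases j
    · exact hα
    · exact analyticAt_const
    · exact hβ
    · exact hγ
  refine ⟨R, Q, hR, hQ, ?_, ?_⟩
  · simp only [R, Matrix.det_fin_two_of, zero_mul, sub_zero]
    exact mul_ne_zero (hα0 0) (mul_ne_zero (hα0 0) hA0)
  · filter_upwards [htr, hslit, hR.eventually_analyticAt, hb.eventually_analyticAt,
      hα.eventually_analyticAt] with z hz hs hRz hbz hαz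
    rw [Matrix.trace_fin_two] at hz
    have hd : A z 1 1 = -a z := eq_neg_of_add_eq_zero_right hz
    have hb0 : b z ≠ 0 := fun h0 => by
      rw [h0, zero_div] at hs
      exact Complex.zero_notMem_slitPlane hs
    have hdα : 2 * dx α z * b z + α z * dx b z = 0 := by
      have h1 : HasFDerivAt b (fderiv ℂ b z) z := hbz.differentiableAt.hasFDerivAt
      have h2 := (((h1.mul_const (b 0)⁻¹).clog hs).const_mul (-(1 / 2) : ℂ)).cexp
      have h3 : dx α z = _ := DFunLike.congr_fun h2.fderiv (1, 0)
      rw [h3]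
      have : b 0 ≠ 0 := hA0
      simp only [smul_apply, smul_eq_mul, ← div_eq_mul_inv, dx]
      change 2 * (α z * _) * _ + _ = _
      field_simp
      ring
    have hdγ : dx γ z = dx α z * b z + α z * dx b z := by
      have h1 := (hαz.differentiableAt.hasFDerivAt.mul hbz.differentiableAt.hasFDerivAt).fderiv
      have h2 : dx γ z = _ := DFunLike.congr_fun h1 (1, 0)
      rw [h2]
      simp [dx]
      ring
    have hent : ∀ i j, fderiv ℂ R z (1, 0) i j = dx (fun w => R w i j) z := fun i j =>
      (fderiv_matrix_apply hRz.differentiableAt (1, 0) i j).symm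
    have e00 : fderiv ℂ R z (1, 0) 0 0 = dx α z := hent 0 0
    have e01 : fderiv ℂ R z (1, 0) 0 1 = 0 := by
      rw [hent]; simp [R, dx]
    have e10 : fderiv ℂ R z (1, 0) 1 0 = dx β z := hent 1 0
    have e11 : fderiv ℂ R z (1, 0) 1 1 = dx γ z := hent 1 1
    have hQα : Q z * α z = P z * dx β z + β z * a z + γ z * c z := div_mul_cancel₀ _ (hα0 z)
    ext i j
    fin_cases i <;> fin_cases j <;>
      simp only [Matrix.add_apply, Matrix.smul_apply, Matrix.mul_apply, Fin.sum_univ_two,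
        Fin.zero_eta, Fin.mk_one, e00, e01, e10, e11, hd] <;> simp [R]
    · rfl
    · rfl
    · rw [hQα]
      simp only [a, c]
      ring
    · rw [hdγ]
      change P z * (dx α z * b z + α z * dx b z) +
        ((P z * dx α z + α z * a z) * b z + -(α z * b z * a z)) = 0
      linear_combination P z * hdα

/-- A constant change of basis makes the upper right entry of a non-zero traceless matrix
non-zero. -/
theorem exists_conj_entry_ne_zero {N : Mat2} (hN : N ≠ 0) (htr : N.trace = 0) :
    ∃ g g' : Mat2, g' * g = 1 ∧ g * g' = 1 ∧ (g * N * g') 0 1 ≠ 0 := by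
  by_cases h01 : N 0 1 = 0
  · by_cases h10 : N 1 0 = 0
    · refine ⟨!![1, 1; 0, 1], !![1, -1; 0, 1], ?_, ?_, ?_⟩
      · ext i j; fin_cases i <;> fin_cases j <;> simp [Matrix.mul_apply, Fin.sum_univ_two]
      · ext i j; fin_cases i <;> fin_cases j <;> simp [Matrix.mul_apply, Fin.sum_univ_two]
      · rw [Matrix.trace_fin_two] at htr
        have h11 := eq_neg_of_add_eq_zero_right htr
        have h00 : N 0 0 ≠ 0 := by
          intro h00
          apply hN
          ext i j
          fin_cases i <;> fin_cases j <;> simp [h00, h01, h10, h11]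
        simp only [Matrix.mul_apply, Fin.sum_univ_two]
        simpa [h01, h10, h11] using h00
    · refine ⟨!![0, 1; 1, 0], !![0, 1; 1, 0], ?_, ?_, ?_⟩
      · ext i j; fin_cases i <;> fin_cases j <;> simp [Matrix.mul_apply, Fin.sum_univ_two]
      · ext i j; fin_cases i <;> fin_cases j <;> simp [Matrix.mul_apply, Fin.sum_univ_two]
      · simp only [Matrix.mul_apply, Fin.sum_univ_two]
        simpa using h10
  · exact ⟨1, 1, by simp, by simp, by simpa using h01⟩

/-- **Companion form.** The system `A dx / P`, with `A` traceless and `A(0) ≠ 0`, is gauge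
equivalent to a companion system with the same denominator. -/
theorem exists_companion_gauge {A : ℂ × H → Mat2} {P : ℂ × H → ℂ}
    (hA : AnalyticAt ℂ A 0) (hP : AnalyticAt ℂ P 0) (htr : ∀ᶠ z in 𝓝 0, (A z).trace = 0)
    (hA0 : A 0 ≠ 0) :
    ∃ (R : ℂ × H → Mat2) (Q : ℂ × H → ℂ), AnalyticAt ℂ R 0 ∧ AnalyticAt ℂ Q 0 ∧
      (R 0).det ≠ 0 ∧
      ∀ᶠ z in 𝓝 0, P z • fderiv ℂ R z (1, 0) + R z * A z = !![0, 1; Q z, 0] * R z := by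
  obtain ⟨g, g', hg, hg', hne⟩ := exists_conj_entry_ne_zero hA0 htr.self_of_nhds
  obtain ⟨R, Q, hR, hQ, hdet, heq⟩ := exists_companion_gauge_of_entry_ne_zero
    (A := fun z => g * A z * g') (P := P) ((analyticAt_const.mul hA).mul analyticAt_const) hP
    (htr.mono fun z hz => by rw [Matrix.trace_mul_comm, ← mul_assoc, hg, one_mul, hz]) hne
  refine ⟨fun z => R z * g, Q, hR.mul analyticAt_const, hQ, ?_, ?_⟩
  · rw [Matrix.det_mul]
    refine mul_ne_zero hdet fun h0 => ?_
    have := congrArg Matrix.det hg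
    rw [Matrix.det_mul, h0, mul_zero, Matrix.det_one] at this
    exact zero_ne_one this
  · filter_upwards [heq, hR.eventually_analyticAt] with z hz hRz
    have hd : fderiv ℂ (fun z => R z * g) z (1, 0) = fderiv ℂ R z (1, 0) * g := by
      have h := (hRz.differentiableAt.hasFDerivAt.mul_const' g).fderiv
      exact (DFunLike.congr_fun h (1, 0)).trans rfl
    have e : P z • fderiv ℂ R z (1, 0) + R z * (g * A z * g') = _ := hz
    rw [hd]
    calc P z • (fderiv ℂ R z (1, 0) * g) + R z * g * A z
        = (P z • fderiv ℂ R z (1, 0) + R z * (g * A z * g')) * g := by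
          rw [add_mul, smul_mul_assoc, mul_assoc (R z) (g * A z * g') g, mul_assoc (g * A z) g' g,
            hg, mul_one, mul_assoc]
      _ = !![0, 1; Q z, 0] * (R z * g) := by rw [e, mul_assoc]

end CompanionForm

/-! ### Vector fields tangent to the divisor -/

section TangentFields

variable {n l : ℕ}

theorem matAnalytic_iff {F : Total n l → Mat2} : MatAnalytic F ↔ AnalyticAt ℂ F 0 :=
  analyticAt_matrix_iff.symm

theorem clm_apply_eq_sum_dir {Y : Type*} [AddCommGroup Y] [Module ℂ Y] [TopologicalSpace Y]
    (L : Total n l →L[ℂ] Y) (x : ℂ) (τ : Fin n → ℂ) :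
    L (x, τ, 0) = x • L (dir none) + ∑ i, τ i • L (dir (some i)) := by
  have h1 : ((x, τ, 0) : Total n l) = x • dir none + ∑ i, τ i • dir (some i) := by
    refine Prod.ext ?_ (Prod.ext ?_ ?_)
    · simp [dir, Prod.fst_sum]
    · simp only [dir, Prod.snd_add, Prod.fst_add, Prod.snd_sum, Prod.fst_sum, Prod.smul_snd,
        Prod.smul_fst, smul_zero, zero_add]
      simpa [Pi.single_apply] using pi_eq_sum_univ' τ
    · simp [dir, Prod.snd_sum]
  rw [h1, map_add, map_smul, map_sum]
  simp

/-- The derivative of `P⁻¹ C`, off `P = 0`. -/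
theorem fderiv_inv_smul {V Y : Type*} [NormedAddCommGroup V] [NormedSpace ℂ V]
    [NormedAddCommGroup Y] [NormedSpace ℂ Y] {P : V → ℂ} {C F : V → Y} {z v : V}
    (hP : DifferentiableAt ℂ P z) (hC : DifferentiableAt ℂ C z) (hPz : P z ≠ 0)
    (hF : F =ᶠ[𝓝 z] fun w => (P w)⁻¹ • C w) : DifferentiableAt ℂ F z ∧
      (P z ^ 2) • fderiv ℂ F z v = P z • fderiv ℂ C z v - fderiv ℂ P z v • C z := by
  have h := ((hasDerivAt_inv hPz).comp_hasFDerivAt z hP.hasFDerivAt).fun_smul hC.hasFDerivAt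
  refine ⟨h.differentiableAt.congr_of_eventuallyEq hF, ?_⟩
  have h' : fderiv ℂ (fun w => (P w)⁻¹ • C w) z = _ := h.fderiv
  rw [hF.fderiv_eq, h']
  simp only [Function.comp_apply, add_apply, smul_apply, ContinuousLinearMap.smulRight_apply, smul_add, smul_smul,
    smul_eq_mul]
  have e1 : P z ^ 2 * (P z)⁻¹ = P z := by field_simp
  have e2 : P z ^ 2 * (-(P z ^ 2)⁻¹ * fderiv ℂ P z v) = -fderiv ℂ P z v := by field_simp
  rw [e1, e2, neg_smul]
  abel

/-- **The tangent fields.** Let `A / P` and `B / P` be the `dx`- and `dt_i`-coefficients of the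
connection. The double commutator formula, with a fixed matrix `L` such that `tr (L A(0)) ≠ 0`,
shows that `B ≡ - f A` modulo `P` for `f = - tr (L B) / tr (L A)`, so that the connection is analytic
on `∂_i + f ∂_x`; the pole bound for `dΩ` says that this field is tangent to `P = 0`. -/
theorem exists_tangent_field {k : ℕ} {c : Fin (k + 1) → ((Fin n → ℂ) × (Fin l → ℂ)) → ℂ}
    {P : Total n l → ℂ} {A B C : Total n l → Mat2} {L : Mat2} {i : Fin n}
    (hPc : P = fun z => monicPoly c z.1 z.2)
    (hP : AnalyticAt ℂ P 0) (hA : AnalyticAt ℂ A 0) (hB : AnalyticAt ℂ B 0) (hC : AnalyticAt ℂ C 0)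
    (hAtr : ∀ᶠ z in 𝓝 0, (A z).trace = 0) (hBtr : ∀ᶠ z in 𝓝 0, (B z).trace = 0)
    (hL : L.trace = 0) (hLA : (L * A 0).trace ≠ 0)
    (hcomm : ∀ᶠ z in 𝓝 0, P z ≠ 0 → A z * B z - B z * A z = P z • C z)
    (hder : ∀ᶠ z in 𝓝 0, P z ≠ 0 →
      fderiv ℂ P z (dir (some i)) • A z - fderiv ℂ P z (dir none) • B z =
        P z • (C z + fderiv ℂ A z (dir (some i)) - fderiv ℂ B z (dir none))) :
    ∃ (f h : Total n l → ℂ) (D : Total n l → Mat2),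
      AnalyticAt ℂ f 0 ∧ AnalyticAt ℂ h 0 ∧ AnalyticAt ℂ D 0 ∧
      (∀ᶠ z in 𝓝 0, fderiv ℂ P z (dir (some i)) + f z * fderiv ℂ P z (dir none) = P z * h z) ∧
      ∀ᶠ z in 𝓝 0, P z ≠ 0 → B z + f z • A z = P z • D z := by
  have htf : ∀ {F : Total n l → Mat2}, AnalyticAt ℂ F 0 →
      AnalyticAt ℂ (fun z => traceForm L (F z)) 0 := fun hF =>
    ((traceForm L).analyticAt _).comp hF
  have hdd : ∀ {Y : Type} [NormedAddCommGroup Y] [NormedSpace ℂ Y] [CompleteSpace Y]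
      {g : Total n l → Y} (v : Total n l),
      AnalyticAt ℂ g 0 → AnalyticAt ℂ (fun z => fderiv ℂ g z v) 0 := fun {Y} _ _ _ g v hg =>
    ((ContinuousLinearMap.apply ℂ Y v).analyticAt _).comp hg.fderiv
  let m : Total n l → ℂ := fun z => traceForm L (A z)
  have hm : AnalyticAt ℂ m 0 := htf hA
  have hm0 : m 0 ≠ 0 := hLA
  let f : Total n l → ℂ := fun z => -(traceForm L (B z) / m z)
  let E : Total n l → Mat2 := fun z =>
    C z + fderiv ℂ A z (dir (some i)) - fderiv ℂ B z (dir none)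
  have hE : AnalyticAt ℂ E 0 := (hC.add (hdd _ hA)).sub (hdd _ hB)
  let h : Total n l → ℂ := fun z => traceForm L (E z) / m z
  let D : Total n l → Mat2 := fun z => (1 / 2 / m z) • (L * C z - C z * L)
  have hf : AnalyticAt ℂ f 0 := ((htf hB).div hm hm0).neg
  have hh : AnalyticAt ℂ h 0 := (htf hE).div hm hm0
  have hD : AnalyticAt ℂ D 0 := (analyticAt_const.div hm hm0).smul
    ((analyticAt_const.mul hC).sub (hC.mul analyticAt_const))
  have hmne : ∀ᶠ z in 𝓝 0, m z ≠ 0 := hm.continuousAt.eventually_ne hm0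
  refine ⟨f, h, D, hf, hh, hD, ?_, ?_⟩
  · refine eventually_eq_of_eq_off_divisor (c := c)
      ((hdd _ hP).add (hf.mul (hdd _ hP))) (hP.mul hh) ?_
    have e : ∀ z : Total n l, monicPoly c z.1 z.2 = P z := fun z => by rw [hPc]
    simp only [e]
    filter_upwards [hder, hmne] with z hz hmz hPz
    have h1 := congrArg (traceForm L) (hz hPz)
    rw [map_sub, map_smul, map_smul, map_smul, smul_eq_mul, smul_eq_mul, smul_eq_mul] at h1
    change _ * m z - _ = P z * traceForm L (E z) at h1
    simp only [f, h]
    field_simp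
    linear_combination h1
  · filter_upwards [hcomm, hmne, hAtr, hBtr] with z hz hmz hAz hBz hPz
    have h1 := double_commutator hL hAz hBz
    rw [hz hPz, mul_smul_comm, smul_mul_assoc, ← smul_sub] at h1
    change m z • B z - traceForm L (B z) • A z = _ at h1
    have h2 : B z + f z • A z = (m z)⁻¹ • (m z • B z - traceForm L (B z) • A z) := by
      rw [smul_sub, smul_smul, smul_smul, inv_mul_cancel₀ hmz, one_smul, sub_eq_add_neg, ← neg_smul]
      simp only [f]
      congr 2
      ring
    rw [h2, h1]
    simp only [D, smul_smul]
    congr 1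
    field_simp

end TangentFields

/-! ### Relative forms -/

section RelativeForm

variable {n l : ℕ} {M : Type*} [NormedRing M] [NormedAlgebra ℂ M]

/-- The coordinate `x` or `t_i`, as a linear form. -/
noncomputable def coordCLM : Option (Fin n) → Total n l →L[ℂ] ℂ
  | none => .fst ℂ ℂ _
  | some i => (ContinuousLinearMap.proj i).comp ((ContinuousLinearMap.fst ℂ _ _).comp
      (.snd ℂ ℂ _))

/-- A relative form `Ω` as a form with values in linear maps, vanishing on `∂/∂ε`. -/
noncomputable def relFormCLM (Ω : Option (Fin n) → Total n l → M) (z : Total n l) :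
    Total n l →L[ℂ] M :=
  ∑ a, (coordCLM a).smulRight (Ω a z)

theorem relFormCLM_apply (Ω : Option (Fin n) → Total n l → M) (z v : Total n l) :
    relFormCLM Ω z v = ∑ a, coordCLM a v • Ω a z := by
  simp [relFormCLM]

theorem coordCLM_dir (a b : Option (Fin n)) :
    coordCLM (l := l) a (dir b) = if a = b then 1 else 0 := by
  cases a <;> cases b <;> simp [coordCLM, dir, Pi.single_apply]

theorem relFormCLM_dir (Ω : Option (Fin n) → Total n l → M) (z : Total n l) (a : Option (Fin n)) :
    relFormCLM Ω z (dir a) = Ω a z := by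
  simp [relFormCLM_apply, coordCLM_dir]

theorem eq_sum_coordCLM_smul_dir {v : Total n l} (hv : v.2.2 = 0) :
    v = ∑ a, coordCLM a v • dir a := by
  have h := clm_apply_eq_sum_dir (.id ℂ (Total n l)) v.1 v.2.1
  have e : v = (v.1, v.2.1, 0) := Prod.ext rfl (Prod.ext rfl hv)
  rw [Fintype.sum_option]
  conv_lhs => rw [e]
  exact h

/-- Flatness of the coefficients, on all pairs of vectors tangent to the fibres `{ε = const}`. -/
theorem relFormCLM_flat {Ω : Option (Fin n) → Total n l → M} {z : Total n l}
    (hd : ∀ a, DifferentiableAt ℂ (Ω a) z)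
    (hflat : ∀ a b, fderiv ℂ (Ω b) z (dir a) - fderiv ℂ (Ω a) z (dir b) =
      Ω a z * Ω b z - Ω b z * Ω a z) {v w : Total n l}
    (hv : v.2.2 = 0) (hw : w.2.2 = 0) :
    DifferentiableAt ℂ (relFormCLM Ω) z ∧
    fderiv ℂ (relFormCLM Ω) z v w - fderiv ℂ (relFormCLM Ω) z w v =
      relFormCLM Ω z v * relFormCLM Ω z w - relFormCLM Ω z w * relFormCLM Ω z v := by
  have hdd : ∀ a, HasFDerivAt (fun z => (coordCLM a).smulRight (Ω a z))
      ((ContinuousLinearMap.smulRightL ℂ (Total n l) M (coordCLM a)).comp (fderiv ℂ (Ω a) z)) z :=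
    fun a => ((ContinuousLinearMap.smulRightL ℂ (Total n l) M (coordCLM a)).hasFDerivAt).comp z
      (hd a).hasFDerivAt
  have hsum' := HasFDerivAt.fun_sum (u := Finset.univ) fun a _ => hdd a
  have hsum : HasFDerivAt (relFormCLM Ω) _ z := hsum'
  refine ⟨hsum.differentiableAt, ?_⟩
  have hap : ∀ v w : Total n l, v.2.2 = 0 → fderiv ℂ (relFormCLM Ω) z v w =
      ∑ a, ∑ b, (coordCLM a v * coordCLM b w) • fderiv ℂ (Ω b) z (dir a) := by
    intro v w hv
    rw [hsum.fderiv]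
    simp only [sum_apply, ContinuousLinearMap.comp_apply,
      ContinuousLinearMap.smulRightL_apply_apply]
    rw [Finset.sum_comm]
    refine Finset.sum_congr rfl fun b _ => ?_
    conv_lhs => rw [eq_sum_coordCLM_smul_dir hv]
    rw [map_sum, ContinuousLinearMap.smulRight_apply, Finset.smul_sum]
    refine Finset.sum_congr rfl fun a _ => ?_
    rw [map_smul, smul_smul, mul_comm]
  have hmul : ∀ v w : Total n l, relFormCLM Ω z v * relFormCLM Ω z w =
      ∑ a, ∑ b, (coordCLM a v * coordCLM b w) • (Ω a z * Ω b z) := by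
    intro v w
    rw [relFormCLM_apply, relFormCLM_apply, Finset.sum_mul_sum]
    simp only [smul_mul_smul_comm]
  rw [hap v w hv, hap w v hw, hmul v w, hmul w v,
    Finset.sum_comm (f := fun a b => (coordCLM a w * coordCLM b v) • fderiv ℂ (Ω b) z (dir a)),
    Finset.sum_comm (f := fun a b => (coordCLM a w * coordCLM b v) • (Ω a z * Ω b z)),
    ← Finset.sum_sub_distrib, ← Finset.sum_sub_distrib]
  refine Finset.sum_congr rfl fun a _ => ?_
  rw [← Finset.sum_sub_distrib, ← Finset.sum_sub_distrib]
  refine Finset.sum_congr rfl fun b _ => ?_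
  rw [mul_comm (coordCLM b w), ← smul_sub, ← smul_sub]
  exact congrArg _ (hflat a b)

end RelativeForm

/-! ### The inverse coordinate change -/

section LocalInverse

variable {T H : Type*} [NormedAddCommGroup T] [NormedSpace ℂ T]
  [NormedAddCommGroup H] [NormedSpace ℂ H] [CompleteSpace T] [CompleteSpace H]

/-- The fibred map `(x, t, ε) ↦ (X, t, ε)` is analytically invertible when `X = x` at `t = 0`. -/
theorem exists_fibred_inverse {X : ℂ × T × H → ℂ} (hX : AnalyticAt ℂ X 0)
    (hinit : ∀ᶠ p in 𝓝 (0 : ℂ × T × H), p.2.1 = 0 → X p = p.1) :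
    ∃ Φ : ℂ × T × H → ℂ × T × H, AnalyticAt ℂ Φ 0 ∧ Φ 0 = 0 ∧
      ∀ᶠ z in 𝓝 0, (X (Φ z), (Φ z).2) = z := by
  let g : ℂ × T × H → ℂ × T × H := fun p => (X p, p.2)
  have hX0 : X 0 = 0 := hinit.self_of_nhds rfl
  have hg0 : g 0 = 0 := Prod.ext hX0 rfl
  have hg : AnalyticAt ℂ g 0 := hX.prod analyticAt_snd
  have hdX : ∀ r : ℂ, fderiv ℂ X 0 (r, 0) = r := fun r => by
    rw [fderiv_eq_of_eq_on_slice (k := Prod.fst) hX.differentiableAt differentiableAt_fst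
      hinit rfl rfl]
    simp [fderiv_fst]
  let e₁ : ℂ × T × H →L[ℂ] ℂ × T × H := (fderiv ℂ X 0).prod (.snd ℂ ℂ (T × H))
  let e₂ : ℂ × T × H →L[ℂ] ℂ × T × H :=
    (ContinuousLinearMap.fst ℂ ℂ (T × H) -
      (fderiv ℂ X 0).comp ((ContinuousLinearMap.inr ℂ ℂ (T × H)).comp (.snd ℂ ℂ (T × H)))).prod
      (.snd ℂ ℂ (T × H))
  have hsplit : ∀ v : ℂ × T × H, fderiv ℂ X 0 v = v.1 + fderiv ℂ X 0 (0, v.2) := fun v => by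
    conv_lhs => rw [show v = (v.1, 0) + (0, v.2) by ext <;> simp]
    rw [map_add, hdX]
  let e : (ℂ × T × H) ≃L[ℂ] (ℂ × T × H) := .equivOfInverse e₁ e₂
    (fun v => Prod.ext (by simp [e₁, e₂, hsplit v]) rfl)
    (fun v => Prod.ext (by
      change fderiv ℂ X 0 (v.1 - fderiv ℂ X 0 (0, v.2), v.2) = v.1
      rw [hsplit]
      exact sub_add_cancel _ _) rfl)
  have hge : HasFDerivAt g (e : ℂ × T × H →L[ℂ] ℂ × T × H) 0 :=
    hX.differentiableAt.hasFDerivAt.prodMk hasFDerivAt_snd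
  have hcd : ContDiffAt ℂ ⊤ g 0 := hg.contDiffAt
  have htop : (⊤ : WithTop ℕ∞) ≠ 0 := by simp
  refine ⟨hcd.localInverse hge htop, ?_, ?_, ?_⟩
  · have := hcd.to_localInverse hge htop
    rw [hg0] at this
    exact this.analyticAt
  · have := hcd.localInverse_apply_image hge htop
    rwa [hg0] at this
  · have := (hcd.hasStrictFDerivAt' hge htop).eventually_right_inverse
    rw [hg0] at this
    exact this

end LocalInverse

/-! ### Numerators and tangent fields of a flat connection -/

section NormalForm

variable {n l k : ℕ}

/-- The numerators of the coefficients of `Ω`: `Ω_a = N_a / P`, with `N_none = A`. -/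
theorem exists_numerators {c : Fin (k + 1) → ((Fin n → ℂ) × (Fin l → ℂ)) → ℂ}
    {P : Total n l → ℂ} {A : Total n l → Mat2} {Ω : RelForm n l}
    (hPc : P = fun z => monicPoly c z.1 z.2) (hP : AnalyticAt ℂ P 0) (hA : MatAnalytic A)
    (hΩ0 : ∀ᶠ z in 𝓝 (0 : Total n l), P z ≠ 0 → Ω none z = (P z)⁻¹ • A z)
    (htr : IsTraceless P Ω) (hpoles : ∀ a, PolesBounded P (Ω a)) :
    ∃ N : Option (Fin n) → Total n l → Mat2, N none = A ∧ (∀ a, AnalyticAt ℂ (N a) 0) ∧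
      (∀ a, ∀ᶠ z in 𝓝 0, (N a z).trace = 0) ∧
      ∀ᶠ z in 𝓝 0, P z ≠ 0 → ∀ a, Ω a z = (P z)⁻¹ • N a z ∧ DifferentiableAt ℂ (Ω a) z ∧
        ∀ v, P z ^ 2 • fderiv ℂ (Ω a) z v =
          P z • fderiv ℂ (N a) z v - fderiv ℂ P z v • N a z := by
  choose B hB hBΩ using hpoles
  let N : Option (Fin n) → Total n l → Mat2 := fun a => a.elim A fun i => B (some i)
  have hN : ∀ a, AnalyticAt ℂ (N a) 0 := by
    rintro (_ | i)
    · exact matAnalytic_iff.1 hA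
    · exact matAnalytic_iff.1 (hB (some i))
  have hNΩ : ∀ᶠ z in 𝓝 0, ∀ a, P z ≠ 0 → Ω a z = (P z)⁻¹ • N a z := by
    refine eventually_all.2 ?_
    rintro (_ | i)
    · exact hΩ0
    · exact hBΩ (some i)
  refine ⟨N, rfl, hN, fun a => ?_, ?_⟩
  · have han : AnalyticAt ℂ (fun z => traceForm 1 (N a z)) 0 :=
      ((traceForm 1).analyticAt _).comp (hN a)
    have := eventually_eq_of_eq_off_divisor (c := c) han (analyticAt_const (v := (0 : ℂ))) (by
      filter_upwards [htr, hNΩ] with z hz1 hz2 hPz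
      have hPz' : P z ≠ 0 := by rw [hPc]; exact hPz
      have h1 := hz1 hPz' a
      rw [hz2 a hPz', Matrix.trace_smul, smul_eq_mul] at h1
      rw [traceForm_apply, one_mul]
      exact (mul_eq_zero.1 h1).resolve_left (inv_ne_zero hPz'))
    filter_upwards [this] with z hz
    rwa [traceForm_apply, one_mul] at hz
  · filter_upwards [hNΩ.eventually_nhds, hP.eventually_analyticAt,
      eventually_all.2 fun a => (hN a).eventually_analyticAt] with z hz hPan hNan hPz a
    have hF : Ω a =ᶠ[𝓝 z] fun w => (P w)⁻¹ • N a w := by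
      filter_upwards [hz, hPan.continuousAt.eventually_ne hPz] with w hw hPw
      exact hw a hPw
    refine ⟨hF.self_of_nhds, ?_, fun v => ?_⟩
    · exact (fderiv_inv_smul (v := 0) hPan.differentiableAt (hNan a).differentiableAt hPz hF).1
    · exact (fderiv_inv_smul hPan.differentiableAt (hNan a).differentiableAt hPz hF).2

end NormalForm

section TangentDistribution

variable {n l k : ℕ}

/-- The two congruences modulo `P` needed for the tangent fields are the flatness equation and the pole
bound for `dΩ`, multiplied by `P²`. The fixed matrix is `L = A(0)ᴴ`, for which `tr (L A(0)) ≠ 0`. -/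
theorem exists_tangent_field_of_isFlat {c : Fin (k + 1) → ((Fin n → ℂ) × (Fin l → ℂ)) → ℂ}
    {P : Total n l → ℂ} {Ω : RelForm n l}
    (hPc : P = fun z => monicPoly c z.1 z.2) (hP : AnalyticAt ℂ P 0)
    (hflat : IsFlat P Ω) (hpd : ∀ a b, PolesBounded P (extDer Ω a b))
    {N : Option (Fin n) → Total n l → Mat2} (hN : ∀ a, AnalyticAt ℂ (N a) 0)
    (hNtr : ∀ a, ∀ᶠ z in 𝓝 0, (N a z).trace = 0) (hN0 : N none 0 ≠ 0)
    (hΩN : ∀ᶠ z in 𝓝 0, P z ≠ 0 → ∀ a, Ω a z = (P z)⁻¹ • N a z ∧ DifferentiableAt ℂ (Ω a) z ∧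
        ∀ v, P z ^ 2 • fderiv ℂ (Ω a) z v =
          P z • fderiv ℂ (N a) z v - fderiv ℂ P z v • N a z) (i : Fin n) :
    ∃ (f h : Total n l → ℂ) (D : Total n l → Mat2),
      AnalyticAt ℂ f 0 ∧ AnalyticAt ℂ h 0 ∧ AnalyticAt ℂ D 0 ∧
      (∀ᶠ z in 𝓝 0, fderiv ℂ P z (dir (some i)) + f z * fderiv ℂ P z (dir none) = P z * h z) ∧
      ∀ᶠ z in 𝓝 0, P z ≠ 0 → Ω (some i) z + f z • Ω none z = D z := by
  let L : Mat2 := (N none 0).conjTranspose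
  have hL : L.trace = 0 := by
    rw [Matrix.trace_conjTranspose, (hNtr none).self_of_nhds, star_zero]
  have hLA : (L * N none 0).trace ≠ 0 := by
    open scoped ComplexOrder in
    exact fun h0 => hN0 (Matrix.trace_conjTranspose_mul_self_eq_zero_iff.1 h0)
  obtain ⟨C, hC, hCd⟩ := hpd none (some i)
  obtain ⟨f, h, D, hf, hh, hD, hPh, hND⟩ := exists_tangent_field hPc hP (hN none) (hN (some i))
    (matAnalytic_iff.1 hC) (hNtr none) (hNtr (some i)) hL hLA
    (by
      filter_upwards [hCd, hflat, hΩN] with z h1 h2 h3 hPz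
      have e := h1 hPz
      rw [h2 hPz, wedgeSelf, (h3 hPz none).1, (h3 hPz (some i)).1, smul_mul_smul_comm,
        smul_mul_smul_comm, ← smul_sub] at e
      have e' := congrArg (fun M => (P z * P z) • M) e
      simp only [smul_smul] at e'
      rw [show P z * P z * ((P z)⁻¹ * (P z)⁻¹) = 1 by field_simp,
        show P z * P z * (P z)⁻¹ = P z by field_simp, one_smul] at e'
      exact e')
    (by
      filter_upwards [hCd, hΩN] with z h1 h3 hPz
      have e := h1 hPz
      rw [extDer, mderiv_eq_fderiv _ (h3 hPz (some i)).2.1,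
        mderiv_eq_fderiv _ (h3 hPz none).2.1] at e
      have e' := congrArg (fun M => (P z ^ 2) • M) e
      simp only [smul_smul] at e'
      rw [smul_sub, (h3 hPz (some i)).2.2, (h3 hPz none).2.2,
        show P z ^ 2 * (P z)⁻¹ = P z by field_simp] at e'
      rw [smul_sub, smul_add, ← e']
      abel)
  refine ⟨f, h, D, hf, hh, hD, hPh, ?_⟩
  filter_upwards [hND, hΩN] with z hz h3 hPz
  have e : D z = (P z)⁻¹ • (N (some i) z + f z • N none z) := by
    rw [hz hPz, smul_smul, inv_mul_cancel₀ hPz, one_smul]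
  rw [(h3 hPz none).1, (h3 hPz (some i)).1, e, smul_add, smul_comm (f z)]

end TangentDistribution

/-! ### The rectifying transformation -/

section RelativeGauge

variable {n l : ℕ} {M : Type*} [NormedRing M] [NormedAlgebra ℂ M] [CompleteSpace M]

/-- The rectification along rays, for a connection given by its coefficients `Ω a`, with one tangent
field `∂_i + f_i ∂_x` for each direction `t_i`. -/
theorem exists_radial_gauge_of_tangent_fields {P : Total n l → ℂ}
    {Ω : Option (Fin n) → Total n l → M} {f h : Fin n → Total n l → ℂ} {D : Fin n → Total n l → M}
    (hf : ∀ i, AnalyticAt ℂ (f i) 0) (hh : ∀ i, AnalyticAt ℂ (h i) 0)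
    (hD : ∀ i, AnalyticAt ℂ (D i) 0) (hP : AnalyticAt ℂ P 0)
    (hΩ : ∀ᶠ z in 𝓝 0, P z ≠ 0 → ∀ a, DifferentiableAt ℂ (Ω a) z)
    (hflat : ∀ᶠ z in 𝓝 0, P z ≠ 0 → ∀ a b,
      fderiv ℂ (Ω b) z (dir a) - fderiv ℂ (Ω a) z (dir b) = Ω a z * Ω b z - Ω b z * Ω a z)
    (hPh : ∀ i, ∀ᶠ z in 𝓝 0,
      fderiv ℂ P z (dir (some i)) + f i z * fderiv ℂ P z (dir none) = P z * h i z)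
    (hΩD : ∀ i, ∀ᶠ z in 𝓝 0, P z ≠ 0 → Ω (some i) z + f i z • Ω none z = D i z) :
    ∃ (X : Total n l → ℂ) (S : Total n l → M), AnalyticAt ℂ X 0 ∧ AnalyticAt ℂ S 0 ∧
      (∀ᶠ p in 𝓝 (0 : Total n l), p.2.1 = 0 → X p = p.1 ∧ S p = 1) ∧
      ∀ᶠ p in 𝓝 (0 : Total n l), P (X p, p.2) ≠ 0 → P (p.1, 0, p.2.2) ≠ 0 ∧
        ∀ (v : Total n l) (a : Option (Fin n)), (fderiv ℂ X p v, v.2) = dir a →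
          fderiv ℂ S p v + S p * Ω a (X p, p.2) =
            v.1 • (Ω none (p.1, 0, p.2.2) * S p) := by
  obtain ⟨X, S, hX, hS, hinit, hgauge⟩ := exists_radial_gauge
    (f := fun z => ∑ i, f i z • .proj i) (h := fun z => ∑ i, h i z • .proj i)
    (D := fun z => ∑ i, ContinuousLinearMap.smulRightL ℂ (Fin n → ℂ) M (.proj i) (D i z))
    (ω := relFormCLM Ω) (P := P)
    (Finset.analyticAt_fun_sum _ fun i _ => (hf i).smul analyticAt_const)
    (Finset.analyticAt_fun_sum _ fun i _ => (hh i).smul analyticAt_const)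
    (Finset.analyticAt_fun_sum _ fun i _ => (ContinuousLinearMap.analyticAt _ _).comp (hD i)) hP
    (by
      filter_upwards [hΩ, hflat] with z h1 h2 hPz
      exact (relFormCLM_flat (h1 hPz) (h2 hPz) (v := 0) (w := 0) rfl rfl).1)
    (by
      filter_upwards [hΩ, hflat] with z h1 h2 hPz v w hv hw
      exact (relFormCLM_flat (h1 hPz) (h2 hPz) hv hw).2)
    (by
      filter_upwards [eventually_all.2 hΩD] with z hz hPz τ
      rw [clm_apply_eq_sum_dir]
      simp only [relFormCLM_dir, sum_apply, smul_apply, ContinuousLinearMap.proj_apply,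
        smul_eq_mul, Finset.sum_smul, ContinuousLinearMap.smulRightL_apply_apply,
        ContinuousLinearMap.smulRight_apply]
      rw [← Finset.sum_add_distrib]
      refine Finset.sum_congr rfl fun i _ => ?_
      rw [← hz i hPz, smul_add, smul_smul, mul_comm (f i z), add_comm])
    (by
      filter_upwards [eventually_all.2 hPh] with z hz τ
      rw [clm_apply_eq_sum_dir]
      simp only [sum_apply, smul_apply, ContinuousLinearMap.proj_apply, smul_eq_mul,
        Finset.sum_mul, Finset.mul_sum]
      rw [← Finset.sum_add_distrib]
      refine Finset.sum_congr rfl fun i _ => ?_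
      linear_combination τ i * hz i)
  refine ⟨X, S, hX, hS, hinit, hgauge.mono fun p hp hPp => ⟨(hp hPp).1, fun v a hva => ?_⟩⟩
  have hv : v.2.2 = 0 := by
    have h2 := congrArg (fun w : Total n l => w.2.2) hva
    cases a <;> exact h2
  have e := (hp hPp).2 v hv
  rw [hva, relFormCLM_dir] at e
  rw [e]
  have e2 : ((v.1, 0, 0) : Total n l) = v.1 • dir none := by simp [dir]
  rw [e2, map_smul, relFormCLM_dir, smul_mul_assoc]

end RelativeGauge

section Main

/-- **Rectification.** The connection is brought to its restriction to `t = 0`, in companion form;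
the new denominator is `P(x, 0, ε)`. -/
theorem exists_transformation_to_slice {n l k : ℕ}
    {c : Fin (k + 1) → ((Fin n → ℂ) × (Fin l → ℂ)) → ℂ}
    {P : Total n l → ℂ} {A : Total n l → Mat2} {Ω : RelForm n l}
    (hc : ∀ j, AnalyticAt ℂ (c j) 0) (hP : P = fun z => monicPoly c z.1 z.2)
    (hA : MatAnalytic A) (hA0 : A 0 ≠ 0)
    (hΩ0 : ∀ᶠ z in 𝓝 (0 : Total n l), P z ≠ 0 → Ω none z = (P z)⁻¹ • A z)
    (htr : IsTraceless P Ω) (hflat : IsFlat P Ω)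
    (hpoles : ∀ a, PolesBounded P (Ω a)) (hpoles_d : ∀ a b, PolesBounded P (extDer Ω a b)) :
    ∃ (φ : Total n l → ℂ) (T : Total n l → Mat2) (Q : ℂ × (Fin l → ℂ) → ℂ), AnalyticAt ℂ Q 0 ∧
      GaugeCoordinateTransforms φ T P Ω (fun z => monicPoly (fun j ε => c j (0, ε)) z.1 z.2.2)
        (constantCompanion (monicPoly fun j ε => c j (0, ε)) fun x ε => Q (x, ε)) := by
  have hPan : AnalyticAt ℂ P 0 := by rw [hP]; exact analyticAt_monicPoly hc
  obtain ⟨N, rfl, hN, hNtr, hΩN⟩ := exists_numerators hP hPan hA hΩ0 htr hpoles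
  choose f h D hf hh hD hPh hΩD using
    exists_tangent_field_of_isFlat hP hPan hflat hpoles_d hN hNtr hA0 hΩN
  obtain ⟨X, S, hX, hS, hinit, hgauge⟩ := exists_radial_gauge_of_tangent_fields hf hh hD hPan
    (hΩN.mono fun z hz hPz a => (hz hPz a).2.1)
    (by
      filter_upwards [hΩN, hflat] with z hz h2 hPz a b
      have e := h2 hPz a b
      rwa [extDer, mderiv_eq_fderiv _ (hz hPz b).2.1, mderiv_eq_fderiv _ (hz hPz a).2.1,
        wedgeSelf] at e)
    hPh hΩD
  obtain ⟨Φ, hΦ, hΦ0, hΦX⟩ := exists_fibred_inverse hX (hinit.mono fun p hp h0 => (hp h0).1)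
  -- the restriction to `t = 0`
  let ι : ℂ × (Fin l → ℂ) → Total n l := fun w => (w.1, 0, w.2)
  have hι : AnalyticAt ℂ ι 0 := analyticAt_fst.prod (analyticAt_const.prod analyticAt_snd)
  have hιt : Tendsto ι (𝓝 0) (𝓝 0) := hι.continuousAt.tendsto
  obtain ⟨R, Q, hR, hQ, hRdet, hRQ⟩ := exists_companion_gauge
    (A := fun w => N none (ι w)) (P := fun w => P (ι w))
    (AnalyticAt.comp (g := N none) (hN none) hι) (AnalyticAt.comp (g := P) hPan hι)
    (hιt.eventually (hNtr none)) hA0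
  let φ : Total n l → ℂ := fun z => (Φ z).1
  let ρ : Total n l → ℂ × (Fin l → ℂ) := fun z => (φ z, z.2.2)
  have hφ : AnalyticAt ℂ φ 0 := analyticAt_fst_comp hΦ
  have hφ0 : φ 0 = 0 := by simp only [φ, hΦ0]; rfl
  have hρ : AnalyticAt ℂ ρ 0 := hφ.prod (analyticAt_snd_comp analyticAt_snd)
  have hρ0 : ρ 0 = 0 := Prod.ext hφ0 rfl
  have hρt : Tendsto ρ (𝓝 0) (𝓝 0) := by
    have := hρ.continuousAt.tendsto
    rwa [hρ0] at this
  have hΦt : Tendsto Φ (𝓝 0) (𝓝 0) := by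
    have := hΦ.continuousAt.tendsto
    rwa [hΦ0] at this
  have hS0 : S 0 = 1 := (hinit.self_of_nhds rfl).2
  let T : Total n l → Mat2 := fun z => R (ρ z) * S (Φ z)
  have hT : AnalyticAt ℂ T 0 :=
    (AnalyticAt.comp (g := R) (by rwa [hρ0]) hρ).mul (AnalyticAt.comp (g := S) (by rwa [hΦ0]) hΦ)
  -- the derivative of the inverse coordinate change
  have hder : ∀ᶠ z in 𝓝 0, ∀ v, (fderiv ℂ X (Φ z) (fderiv ℂ Φ z v), (fderiv ℂ Φ z v).2) = v := by
    filter_upwards [hΦX.eventually_nhds, hΦ.eventually_analyticAt,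
      hΦt.eventually hX.eventually_analyticAt] with z hz hΦz hXz v
    have h1 := (hXz.differentiableAt.hasFDerivAt.comp z hΦz.differentiableAt.hasFDerivAt).prodMk
      hΦz.differentiableAt.hasFDerivAt.snd
    have h2 := (hasFDerivAt_id (𝕜 := ℂ) z).congr_of_eventuallyEq
      (hz : (fun z => (X (Φ z), (Φ z).2)) =ᶠ[𝓝 z] id)
    exact DFunLike.congr_fun (h1.unique h2) v
  have hpφ : ∀ᶠ z in 𝓝 0, ∀ a, pderiv a φ z = (fderiv ℂ Φ z (dir a)).1 := by
    filter_upwards [hΦ.eventually_analyticAt] with z hz a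
    exact DFunLike.congr_fun hz.differentiableAt.hasFDerivAt.fst.fderiv (dir a)
  refine ⟨φ, T, Q, hQ, hφ, hφ0, ?_, matAnalytic_iff.2 hT, ?_, ?_⟩
  · rw [hpφ.self_of_nhds]
    intro h0
    have h1 := hder.self_of_nhds (dir none)
    have h2 : fderiv ℂ Φ 0 (dir none) = 0 := Prod.ext h0 (Prod.ext_iff.1 h1).2
    rw [h2, map_zero] at h1
    exact zero_ne_one ((Prod.ext_iff.1 h1).1 : (0 : ℂ) = 1)
  · simp only [T, hρ0, hΦ0, hS0, mul_one]
    exact hRdet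
  · filter_upwards [hΦX, hΦt.eventually hgauge, hder, hpφ, hT.eventually_analyticAt,
      hρ.eventually_analyticAt, hΦ.eventually_analyticAt, hρt.eventually hR.eventually_analyticAt,
      hΦt.eventually hS.eventually_analyticAt, hρt.eventually hRQ, (hιt.comp hρt).eventually hΩN]
      with z hΦz hg hd hp hTz hρz hΦaz hRz hSz hRQz hΩz hPz
    have hΦz2 : (Φ z).2 = z.2 := (Prod.ext_iff.1 hΦz).2
    obtain ⟨hP0, hg⟩ := hg (by rw [hΦz]; exact hPz)
    have hι' : ((Φ z).1, 0, (Φ z).2.2) = ι (ρ z) := by rw [hΦz2]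
    have hPι : P (ι (ρ z)) = monicPoly (fun j ε => c j (0, ε)) (φ z) z.2.2 := by
      rw [hP]; rfl
    rw [hι'] at hP0 hg
    refine ⟨?_, fun a => ?_⟩
    · rw [hPι] at hP0
      exact hP0
    · set v := fderiv ℂ Φ z (dir a) with hv
      have hgv := hg v a (hd (dir a))
      have hΩι : Ω none (ι (ρ z)) = (P (ι (ρ z)))⁻¹ • N none (ι (ρ z)) := (hΩz hP0 none).1
      rw [hΦz, hΩι] at hgv
      have hρd : fderiv ℂ ρ z (dir a) = (v.1, 0) := by
        have h1 := hΦaz.differentiableAt.hasFDerivAt.fst.prodMk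
          (hasFDerivAt_snd (𝕜 := ℂ) (p := z)).snd
        have h2 : fderiv ℂ ρ z = _ := h1.fderiv
        rw [h2]
        cases a <;> rfl
      have hTd : fderiv ℂ T z (dir a) =
          R (ρ z) * fderiv ℂ S (Φ z) v + fderiv ℂ R (ρ z) (v.1, 0) * S (Φ z) := by
        have h1 := (hRz.differentiableAt.hasFDerivAt.comp z hρz.differentiableAt.hasFDerivAt).mul'
          (hSz.differentiableAt.hasFDerivAt.comp z hΦaz.differentiableAt.hasFDerivAt)
        refine (DFunLike.congr_fun h1.fderiv (dir a)).trans ?_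
        rw [← hρd]
        rfl
      have hRd : fderiv ℂ R (ρ z) (v.1, 0) = v.1 • fderiv ℂ R (ρ z) (1, 0) := by
        rw [← map_smul]; simp
      have hpull : pullback φ (constantCompanion (monicPoly fun j ε => c j (0, ε))
          fun x ε => Q (x, ε)) a z =
          v.1 • ((P (ι (ρ z)))⁻¹ • !![0, 1; Q (ρ z), 0]) := by
        rw [hPι, hv, ← hp a]
        cases a
        · rfl
        · simp only [pullback, constantCompanion, add_zero]
          rfl
      rw [mderiv_eq_fderiv a hTz.differentiableAt, hTd, hRd, hpull]
      have hS' : fderiv ℂ S (Φ z) v = v.1 • ((P (ι (ρ z)))⁻¹ • N none (ι (ρ z)) * S (Φ z)) -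
          S (Φ z) * Ω a z := eq_sub_of_add_eq hgv
      have hR' : fderiv ℂ R (ρ z) (1, 0) = (P (ι (ρ z)))⁻¹ •
          (!![0, 1; Q (ρ z), 0] * R (ρ z) - R (ρ z) * N none (ι (ρ z))) := by
        rw [← hRQz, add_sub_cancel_right, smul_smul, inv_mul_cancel₀ hP0, one_smul]
      rw [hS', hR']
      simp only [T, mul_sub, sub_mul, smul_sub, mul_smul_comm, smul_mul_assoc, mul_assoc]
      abel

end Main

end MatrixNorm

end ConfluentIso

open ConfluentIso in
theorem theorem5 (n l k : ℕ)
    (c : Fin (k + 1) → ((Fin n → ℂ) × (Fin l → ℂ)) → ℂ)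
    (P : Total n l → ℂ) (A : Total n l → Mat2) (Ω : RelForm n l)
    (hc : ∀ j, AnalyticAt ℂ (c j) 0) (hc0 : ∀ j, c j 0 = 0)
    (hP : P = fun z => monicPoly c z.1 z.2)
    (hA : MatAnalytic A) (hA0 : A 0 ≠ 0)
    (hΩ0 : ∀ᶠ z in 𝓝 (0 : Total n l), P z ≠ 0 → Ω none z = (P z)⁻¹ • A z)
    (htr : IsTraceless P Ω)
    (hflat : IsFlat P Ω)
    (htrans : Transversality P Ω)
    (hcross : NonCrossing P) :
    ∃ (φ : Total n l → ℂ) (T : Total n l → Mat2)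
      (c' : Fin (k + 1) → (Fin l → ℂ) → ℂ) (Q' : ℂ → (Fin l → ℂ) → ℂ),
      (∀ j, AnalyticAt ℂ (c' j) 0) ∧ (∀ j, c' j 0 = 0) ∧
      AnalyticAt ℂ (fun w : ℂ × (Fin l → ℂ) => Q' w.1 w.2) 0 ∧
      GaugeCoordinateTransforms φ T P Ω
        (fun z => monicPoly c' z.1 z.2.2) (constantCompanion (monicPoly c') Q') := by
  obtain ⟨φ, T, Q, hQ, h⟩ := exists_transformation_to_slice hc hP hA hA0 hΩ0 htr hflat
    htrans.poles htrans.poles_d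
  exact ⟨φ, T, fun j ε => c j (0, ε), fun x ε => Q (x, ε),
    fun j => AnalyticAt.comp (g := c j) (hc j) (analyticAt_const.prod analyticAt_id),
    hc0, hQ, h⟩
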